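/- Let $d\in\mathbb N$, $\mathrm{Re},\mathrm{We},b>0$, $\varepsilon\in(0,1)$, $T\in\mathbb R$, and let $\mathcal D\subset\mathbb R^d$ be a bounded open set. Consider the FENE-P system $$\mathrm{Re}\,(\partial_t u+u\cdot\nabla u)=(1-\varepsilon)\Delta u-\nabla p+\operatorname{div}\tau,\qquad \operatorname{div}u=0,\qquad \tau=\frac{\varepsilon}{\mathrm{We}}\Big(\frac{A}{1-\operatorname{tr}(A)/b}-I\Big),$$ $$\partial_t A+u\cdot\nabla A=\nabla u\,A+A(\nabla u)^T-\frac1{\mathrm{We}}\frac{A}{1-\operatorname{tr}(A)/b}+\frac1{\mathrm{We}}I$$ in $(0,T)\times\mathcal D$, with $u=0$ on $[0,T)\times\partial\mathcal D$, where $(\nabla u)_{ij}=\partial u_i/\partial x_j$ and $(\operatorname{div}\tau)_i=\sum_j\partial_j\tau_{ij}$, for a velocity $u(t,x)\in\mathbb R^d$, a pressure $p(t,x)\in\mathbb R$ and a conformation tensor $A(t,x)\in\mathbb R^{d\times d}$. Let $(u,p,A)$ be a regular solution: $u$ and $A$ are $C^1$ on $[0,T)\times\overline{\mathcal D}$, and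 for each $t\in(0,T)$, $u(t,\cdot)$ is $C^2$ and $p(t,\cdot)$ is $C^1$ on $\overline{\mathcal D}$. Assume that for all $x\in\overline{\mathcal D}$ the matrix $A(0,x)$ is symmetric positive definite and $\operatorname{tr}A(0,x)<b$. Then for every $t\in[0,T)$: $A(t,x)$ is symmetric positive definite with $\operatorname{tr}A(t,x)<b$ for all $x\in\overline{\mathcal D}$; all the integrands below are integrable over $\mathcal D$; and the free energy is differentiable at $t$ (one-sidedly at $t=0$), with $$\frac{d}{dt}\left(\frac{\mathrm{Re}}2\int_{\mathcal D}|u|^2+\frac{\varepsilon}{2\mathrm{We}}\int_{\mathcal D}\big(-\ln\det A-b\ln(1-\operatorname{tr}(A)/b)\big)\right)$$ $$+(1-\varepsilon)\int_{\mathcal D}|\nabla u|^2+\frac{\varepsilon}{2\mathrm{We}^2}\int_{\mathcal D}\left(\frac{\operatorname{tr}A}{(1-\operatorname{tr}(A)/b)^2}-\frac{2d}{1-\operatorname{tr}(A)/b}+\operatorname{tr}(A^{-1})\right)=0,$$ where $|\nabla u|^2=\sum_{i,j}(\partial_j u_i)^2$. -/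

import Mathlib

noncomputable section

namespace FENEP

/-- The Euclidean space `ℝ^d`. -/
abbrev E (d : ℕ) : Type := EuclideanSpace ℝ (Fin d)

/-- The partial derivative `∂f/∂x_j` of a scalar field at `x`. -/
def partialDeriv {d : ℕ} (j : Fin d) (f : E d → ℝ) (x : E d) : ℝ :=
  fderiv ℝ f x (EuclideanSpace.single j 1)

/-- The velocity gradient, with the convention `(∇v)_{ij} = ∂v_i/∂x_j`. -/
def gradMat {d : ℕ} (v : E d → E d) (x : E d) : Matrix (Fin d) (Fin d) ℝ :=
  Matrix.of fun i j => partialDeriv j (fun y => v y i) x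

/-- The divergence `∑ᵢ ∂v_i/∂x_i` of a vector field. -/
def divVec {d : ℕ} (v : E d → E d) (x : E d) : ℝ :=
  ∑ i, partialDeriv i (fun y => v y i) x

/-- The divergence of a matrix field, `(div σ)_i = ∑ⱼ ∂σ_{ij}/∂x_j`. -/
def divMat {d : ℕ} (σ : E d → Matrix (Fin d) (Fin d) ℝ) (x : E d) : E d :=
  WithLp.toLp 2 fun i => ∑ j, partialDeriv j (fun y => σ y i j) x

/-- The squared Euclidean (Frobenius) norm `M : M = ∑ᵢⱼ M_{ij}²` of a matrix. -/
def sqNorm {d : ℕ} (M : Matrix (Fin d) (Fin d) ℝ) : ℝ := ∑ i, ∑ j, M i j ^ 2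

/-- The spring factor `1 - tr(M)/b`. -/
def springFactor {d : ℕ} (b : ℝ) (M : Matrix (Fin d) (Fin d) ℝ) : ℝ := 1 - M.trace / b

/-- The stress `τ = (ε/We) (M / (1 - tr(M)/b) - I)`. -/
def stress {d : ℕ} (We ε b : ℝ) (M : Matrix (Fin d) (Fin d) ℝ) : Matrix (Fin d) (Fin d) ℝ :=
  (ε / We) • ((springFactor b M)⁻¹ • M - 1)

/-- `(u, p, A)` is a regular solution, on the time interval `[0, T)` and in `D`, of the FENE-P
system with no-slip boundary condition: `u` and `A` are `C¹` in `(t, x)` up to the boundary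
and up to the initial time, `u` is `C²` and `p` is `C¹` in `x` up to the boundary at positive times,
and the equations hold pointwise in `(0, T) × D`. Neither symmetry nor positivity of `A`
nor a bound on its trace is part of the definition; positivity and `tr A < b` persist if they hold
at time `0`, so the quotient by `1 - tr(A)/b` is then always a genuine one. -/
structure IsRegularSolution {d : ℕ} (Re We ε b T : ℝ) (D : Set (E d))
    (u : ℝ → E d → E d) (p : ℝ → E d → ℝ) (A : ℝ → E d → Matrix (Fin d) (Fin d) ℝ) :
    Prop where
  velocity_regular :
    ContDiffOn ℝ 1 (fun z : ℝ × E d => u z.1 z.2) (Set.Ico 0 T ×ˢ closure D)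
  velocity_regular_space : ∀ t ∈ Set.Ioo 0 T, ContDiffOn ℝ 2 (u t) (closure D)
  pressure_regular : ∀ t ∈ Set.Ioo 0 T, ContDiffOn ℝ 1 (p t) (closure D)
  conformation_regular : ∀ i j,
    ContDiffOn ℝ 1 (fun z : ℝ × E d => A z.1 z.2 i j) (Set.Ico 0 T ×ˢ closure D)
  no_slip : ∀ t ∈ Set.Ico 0 T, ∀ x ∈ frontier D, u t x = 0
  /-- `Re (∂ₜu + u·∇u) = (1 - ε) Δu - ∇p + div τ` -/
  momentum : ∀ t ∈ Set.Ioo 0 T, ∀ x ∈ D,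
    Re • (deriv (fun s => u s x) t + fderiv ℝ (u t) x (u t x)) =
      (1 - ε) • Laplacian.laplacian (u t) x - gradient (p t) x
        + divMat (fun y => stress We ε b (A t y)) x
  incompressible : ∀ t ∈ Set.Ioo 0 T, ∀ x ∈ D, divVec (u t) x = 0
  /-- `∂ₜA + u·∇A = ∇u A + A (∇u)ᵀ - (1/We) A / (1 - tr(A)/b) + (1/We) I`, entry by entry -/
  conformation : ∀ t ∈ Set.Ioo 0 T, ∀ x ∈ D, ∀ i j,
    deriv (fun s => A s x i j) t + fderiv ℝ (fun y => A t y i j) x (u t x) =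
      (gradMat (u t) x * A t x + A t x * (gradMat (u t) x).transpose
        - (1 / We) • ((springFactor b (A t x))⁻¹ • A t x)
        + (1 / We) • (1 : Matrix (Fin d) (Fin d) ℝ)) i j

/-- The entropy density `-ln det M - b ln(1 - tr(M)/b)`. -/
def entropyDensity {d : ℕ} (b : ℝ) (M : Matrix (Fin d) (Fin d) ℝ) : ℝ :=
  -Real.log M.det - b * Real.log (springFactor b M)

/-- The density `tr M / (1 - tr(M)/b)² - 2d / (1 - tr(M)/b) + tr(M⁻¹)`. -/
def dissipationDensity {d : ℕ} (b : ℝ) (M : Matrix (Fin d) (Fin d) ℝ) : ℝ :=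
  M.trace / springFactor b M ^ 2 - 2 * (d : ℝ) / springFactor b M + (M⁻¹).trace

end FENEP

end

/-! The energy law comes from testing the momentum equation with `u` and the conformation equation
with the derivative of the entropy, `-A⁻¹ + (1 - tr(A)/b)⁻¹ I`, weighted by `ε/(2We)`. The
stretching terms then produce exactly the stress power `τ : ∇u`, which the momentum equation
dissipates with the opposite sign; what remains is viscous dissipation and `dissipationDensity`
(`entropy_production`, `BoundaryDerivatives.kinetic_balance`,
`BoundaryDerivatives.entropy_balance`).

The quotients and logarithms make sense only if `A` stays positive definite with `tr A < b`. Both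
follow from `transport_max_principle`: transport is invisible at a spatial extremum inside `D`, and
on the frontier `u = 0`. Near `tr A = b` the relaxation term blows up and pushes the trace back;
near a vanishing eigenvalue the source `I/We` dominates. Symmetry is propagated separately, by a
Grönwall argument for `A - Aᵀ`.

No regularity of the frontier is assumed. Integration by parts always involves a factor vanishing
there: its extension by zero is Lipschitz, and its derivative vanishes almost everywhere on its zero
set, even if the frontier has positive measure (`setIntegral_partialDeriv_eq_zero`). Derivatives at
boundary points are replaced throughout by continuous extensions of the interior ones.

The identity is proved for `t > 0` and reaches `t = 0` through continuity of the energy and of its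
derivative. -/

noncomputable section

open Set Filter Topology MeasureTheory

namespace FENEP

/-! ### Derivatives up to the boundary, and the divergence theorem on bounded open sets. -/

/-- The derivative of a function that is `C^{n+1}` up to the boundary extends to a `C^n` function
up to the boundary. -/
theorem exists_contDiffOn_hasFDerivWithinAt {X Y : Type*} [NormedAddCommGroup X] [NormedSpace ℝ X]
    [NormedAddCommGroup Y] [NormedSpace ℝ Y] {f : X → Y} {S S₀ : Set X} {n : ℕ}
    (hf : ContDiffOn ℝ (n + 1 : ℕ) f S) (hS₀ : S₀ ⊆ S) (hS : S ⊆ closure S₀)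
    (hu : UniqueDiffOn ℝ S₀) :
    ∃ f' : X → X →L[ℝ] Y, ContDiffOn ℝ n f' S ∧ ∀ z ∈ S, HasFDerivWithinAt f (f' z) S z := by
  have key : ∀ z ∈ S, ∃ g : X → X →L[ℝ] Y, ContDiffWithinAt ℝ n g S z ∧
      ∃ V ∈ 𝓝[S] z, ContinuousOn g V ∧ V ⊆ S ∧ ∀ y ∈ V, HasFDerivWithinAt f (g y) S y := by
    intro z hz
    have h := hf z hz
    have hn : ((n : ℕ) : WithTop ℕ∞) ≠ (⊤ : ℕ∞) := by
      intro h; exact absurd h (by exact_mod_cast ENat.natCast_ne_top n)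
    rw [Nat.cast_add, Nat.cast_one, contDiffWithinAt_succ_iff_hasFDerivWithinAt' hn] at h
    obtain ⟨U, hU, hUs, -, g, hg, hgc⟩ := h
    rw [insert_eq_of_mem hz] at hU hUs
    have hg0 : ContDiffWithinAt ℝ 0 g S z := hgc.of_le (by simp)
    obtain ⟨W, hW, hWc⟩ := (contDiffWithinAt_zero hz).1 hg0
    refine ⟨g, hgc, U ∩ (S ∩ W), inter_mem hU (inter_mem self_mem_nhdsWithin hW),
      hWc.mono inter_subset_right, fun y hy => hy.2.1, fun y hy => hg y hy.1⟩
  choose! g hgc V hV hgV hVS hgd using key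
  -- Derivatives within `S` need not be unique, so the local choices `g z` could disagree. On the
  -- dense subset `S₀` they are forced to equal `fderivWithin ℝ f S₀`; its extension by continuity
  -- therefore glues them.
  have heq : ∀ z ∈ S, ∀ y ∈ V z ∩ S₀, fderivWithin ℝ f S₀ y = g z y := fun z hz y hy =>
    ((hgd z hz y hy.1).mono hS₀).fderivWithin (hu y hy.2)
  have hlim : ∀ z ∈ S, ∀ y ∈ V z, V z ∈ 𝓝[S] y →
      Tendsto (fderivWithin ℝ f S₀) (𝓝[S₀] y) (𝓝 (g z y)) := by
    intro z hz y hy hVy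
    have h1 : Tendsto (g z) (𝓝[S₀] y) (𝓝 (g z y)) :=
      ((hgV z hz y hy).mono_of_mem_nhdsWithin hVy).mono hS₀
    refine h1.congr' ?_
    filter_upwards [nhdsWithin_mono y hS₀ hVy, self_mem_nhdsWithin] with w hw hw'
    exact (heq z hz w ⟨hw, hw'⟩).symm
  have hext : ∀ z ∈ S, extendFrom S₀ (fderivWithin ℝ f S₀) =ᶠ[𝓝[S] z] g z := by
    intro z hz
    filter_upwards [eventually_mem_nhdsWithin_iff.2 (hV z hz), hV z hz] with y hy hy'
    exact extendFrom_eq (hS (hVS z hz hy')) (hlim z hz y hy' hy)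
  refine ⟨extendFrom S₀ (fderivWithin ℝ f S₀), fun z hz => ?_, fun z hz => ?_⟩
  · exact (hgc z hz).congr_of_eventuallyEq (hext z hz) ((hext z hz).self_of_nhdsWithin hz)
  · rw [(hext z hz).self_of_nhdsWithin hz]
    exact hgd z hz z (mem_of_mem_nhdsWithin hz (hV z hz))

/-- The mean value inequality holds along any segment inside `D`. A segment that leaves `D` first
meets the complement at a frontier point, where `h = 0`, so convexity of `D` is not needed. -/
theorem lipschitzWith_indicator {d : ℕ} {D : Set (E d)} (hDo : IsOpen D) {h : E d → ℝ}
    {K : NNReal} (hc : ContinuousOn h (closure D)) (h0 : ∀ x ∈ frontier D, h x = 0)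
    (hd : ∀ x ∈ D, DifferentiableAt ℝ h x) (hK : ∀ x ∈ D, ‖fderiv ℝ h x‖₊ ≤ K) :
    LipschitzWith K (D.indicator h) := by
  have hfr : ∀ x ∈ closure D, x ∉ D → h x = 0 := fun x hx hx' =>
    h0 x ⟨hx, by rwa [hDo.interior_eq]⟩
  have seg : ∀ x y : E d, (∀ s ∈ Ico (0:ℝ) 1, x + s • (y - x) ∈ D) → ‖h y - h x‖ ≤ K * ‖y - x‖ := by
    intro x y hs
    have hcl : ∀ s ∈ Icc (0:ℝ) 1, x + s • (y - x) ∈ closure D := by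
      intro s hs'
      have : MapsTo (fun s : ℝ => x + s • (y - x)) (closure (Ico 0 1)) (closure D) :=
        MapsTo.closure hs (by fun_prop)
      rw [closure_Ico zero_ne_one] at this
      exact this hs'
    have hc' : ContinuousOn (fun s : ℝ => h (x + s • (y - x))) (Icc 0 1) :=
      hc.comp (by fun_prop) hcl
    have := norm_image_sub_le_of_norm_deriv_right_le_segment (f := fun s : ℝ => h (x + s • (y - x)))
      (f' := fun s => fderiv ℝ h (x + s • (y - x)) (y - x)) (C := K * ‖y - x‖) hc' ?_ ?_ 1 (by simp)
    · simpa using this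
    · intro s hs'
      have h1 : HasDerivAt (fun s : ℝ => x + s • (y - x)) (y - x) s := by
        simpa using ((hasDerivAt_id s).smul_const (y - x)).const_add x
      exact ((hd _ (hs s hs')).hasFDerivAt.comp_hasDerivAt s h1).hasDerivWithinAt
    · intro s hs'
      exact (ContinuousLinearMap.le_opNorm _ _).trans
        (mul_le_mul_of_nonneg_right (by exact_mod_cast hK _ (hs s hs')) (norm_nonneg _))
  have key : ∀ x ∈ D, ∀ y, (∀ s ∈ Icc (0:ℝ) 1, x + s • (y - x) ∈ D) ∨
      ‖h x‖ ≤ K * ‖y - x‖ := by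
    intro x hx y
    by_cases hall : ∀ s ∈ Icc (0:ℝ) 1, x + s • (y - x) ∈ D
    · exact Or.inl hall
    right
    push Not at hall
    -- The least element of `B` is the first exit time `s₀` from `D` along the segment.
    let B : Set ℝ := Icc 0 1 ∩ (fun s : ℝ => x + s • (y - x)) ⁻¹' Dᶜ
    have hB : IsCompact B := isCompact_Icc.inter_right
      (hDo.isClosed_compl.preimage (by fun_prop))
    obtain ⟨s₀, hs₀, hmin⟩ := hB.exists_isLeast (by obtain ⟨s, hs, hs'⟩ := hall; exact ⟨s, hs, hs'⟩)
    have hs0pos : 0 ≤ s₀ := hs₀.1.1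
    have hseg : ∀ s ∈ Ico (0:ℝ) 1, x + s • ((x + s₀ • (y - x)) - x) ∈ D := by
      intro s hs
      by_contra hcon
      have : s * s₀ ∈ B := by
        refine ⟨⟨mul_nonneg hs.1 hs0pos, mul_le_one₀ hs.2.le hs0pos hs₀.1.2⟩, ?_⟩
        simpa [smul_smul] using hcon
      have h2 := hmin this
      -- Minimality gives `s₀ ≤ s * s₀` with `s < 1`, hence `s₀ = 0`; but the segment starts in `D`.
      have : s₀ = 0 := by nlinarith [hs.2, hs.1]
      have h3 := hs₀.2
      simp [this, hx] at h3
    have h1 := seg x (x + s₀ • (y - x)) hseg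
    have hcl : x + s₀ • (y - x) ∈ closure D := by
      have : MapsTo (fun s : ℝ => x + s • ((x + s₀ • (y - x)) - x)) (closure (Ico 0 1)) (closure D) :=
        MapsTo.closure hseg (by fun_prop)
      rw [closure_Ico zero_ne_one] at this
      simpa using this (right_mem_Icc.2 zero_le_one)
    rw [hfr _ hcl hs₀.2] at h1
    simp only [zero_sub, norm_neg, add_sub_cancel_left, norm_smul, Real.norm_of_nonneg hs0pos] at h1
    refine h1.trans (mul_le_mul_of_nonneg_left ?_ K.2)
    exact mul_le_of_le_one_left (norm_nonneg _) hs₀.1.2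
  have sq : ∀ x y : E d, ‖D.indicator h x - D.indicator h y‖ ≤ K * ‖x - y‖ ∨ (x ∈ D ∧ y ∈ D) := by
    intro x y
    by_cases hx : x ∈ D <;> by_cases hy : y ∈ D
    · exact Or.inr ⟨hx, hy⟩
    · left
      rcases key x hx y with h1 | h1
      · exact absurd (by simpa using h1 1 (by simp)) hy
      · simpa [hx, hy, norm_sub_rev] using h1
    · left
      rcases key y hy x with h1 | h1
      · exact absurd (by simpa using h1 1 (by simp)) hx
      · simpa [hx, hy] using h1
    · left; simp [hx, hy]; positivity
  refine LipschitzWith.of_dist_le_mul fun x y => ?_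
  rw [dist_eq_norm, dist_eq_norm]
  rcases sq x y with h1 | ⟨hx, hy⟩
  · exact h1
  by_cases hall : ∀ s ∈ Icc (0:ℝ) 1, y + s • (x - y) ∈ D
  · simpa [hx, hy] using seg y x fun s hs => hall s ⟨hs.1, hs.2.le⟩
  push Not at hall
  obtain ⟨s, hs, hs'⟩ := hall
  -- Since `w ∉ D`, the extension vanishes at `w`. Each half of the chord then obeys the bound, and
  -- the two lengths add up to `‖x - y‖`.
  set w := y + s • (x - y) with hw
  have h1 : ‖D.indicator h x - D.indicator h w‖ ≤ K * ‖x - w‖ :=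
    (sq x w).resolve_right fun h => hs' h.2
  have h2 : ‖D.indicator h w - D.indicator h y‖ ≤ K * ‖w - y‖ :=
    (sq w y).resolve_right fun h => hs' h.1
  have e1 : ‖x - w‖ = (1 - s) * ‖x - y‖ := by
    rw [← Real.norm_of_nonneg (sub_nonneg.2 hs.2), ← norm_smul]
    congr 1; rw [hw]; module
  have e2 : ‖w - y‖ = s * ‖x - y‖ := by
    rw [hw, add_sub_cancel_left, norm_smul, Real.norm_of_nonneg hs.1]
  calc _ ≤ _ := norm_sub_le_norm_sub_add_norm_sub _ (D.indicator h w) _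
    _ ≤ K * ‖x - w‖ + K * ‖w - y‖ := add_le_add h1 h2
    _ = _ := by rw [e1, e2]; ring

/-- On its zero set, `G` is approximated by the zero map with constant `0`, so its derivative
vanishes at almost every point of that set. Multiplying by a fixed nonzero vector `e` turns `G` into
a self-map of `E d`, the form that the approximation estimate takes. -/
theorem _root_.LipschitzWith.ae_fderiv_eq_zero_of_eq_zero {d : ℕ} {G : E d → ℝ} {K : NNReal}
    (hG : LipschitzWith K G) : ∀ᵐ x, G x = 0 → fderiv ℝ G x = 0 := by
  rcases subsingleton_or_nontrivial (E d) with hs | hs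
  · exact .of_forall fun x _ => Subsingleton.elim _ _
  obtain ⟨e, he⟩ := exists_ne (0 : E d)
  set s : Set (E d) := {x | G x = 0} ∩ {x | DifferentiableAt ℝ G x} with hs_def
  have hsm : MeasurableSet s := (hG.continuous.measurable (measurableSet_singleton 0)).inter
    (measurableSet_of_differentiableAt ℝ G)
  have happ : ApproximatesLinearOn (fun x => G x • e) (0 : E d →L[ℝ] E d) s 0 := by
    intro x hx y hy
    simp [show G x = 0 from hx.1, show G y = 0 from hy.1]
  have h := happ.norm_fderiv_sub_le volume hsm (fun x => (fderiv ℝ G x).smulRight e)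
    (fun x hx => (hx.2.hasFDerivAt.smul_const e).hasFDerivWithinAt)
  rw [ae_restrict_iff' hsm] at h
  filter_upwards [h, hG.ae_differentiableAt] with x hx hx' hx0
  have h1 := hx ⟨hx0, hx'⟩
  simp only [sub_zero, nonpos_iff_eq_zero, nnnorm_eq_zero] at h1
  ext w
  have := congrArg (fun L : E d →L[ℝ] E d => L w) h1
  simpa [he] using this

theorem partialDeriv_eq_of_hasFDerivWithinAt {d : ℕ} {D : Set (E d)} (hDo : IsOpen D)
    {h : E d → ℝ} {L : E d →L[ℝ] ℝ} {x : E d} (hx : x ∈ D)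
    (hL : HasFDerivWithinAt h L (closure D) x) (j : Fin d) :
    partialDeriv j h x = L (EuclideanSpace.single j 1) := by
  rw [partialDeriv, (hL.hasFDerivAt (mem_of_superset (hDo.mem_nhds hx) subset_closure)).fderiv]

theorem exists_continuousOn_partialDeriv {d : ℕ} {D : Set (E d)} (hDo : IsOpen D) {h : E d → ℝ}
    (hh : ContDiffOn ℝ 1 h (closure D)) (j : Fin d) :
    ∃ g : E d → ℝ, ContinuousOn g (closure D) ∧ ∀ x ∈ D, partialDeriv j h x = g x := by
  obtain ⟨h', hc, hd⟩ := exists_contDiffOn_hasFDerivWithinAt (n := 0) (by simpa using hh)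
    subset_closure subset_rfl hDo.uniqueDiffOn
  exact ⟨fun x => h' x (EuclideanSpace.single j 1), hc.continuousOn.clm_apply continuousOn_const,
    fun x hx => partialDeriv_eq_of_hasFDerivWithinAt hDo hx (hd x (subset_closure hx)) j⟩

theorem integrableOn_of_eqOn_continuousOn_closure {d : ℕ} {D : Set (E d)} (hDo : IsOpen D)
    (hDb : Bornology.IsBounded D) {f g : E d → ℝ} (hg : ContinuousOn g (closure D))
    (hfg : ∀ x ∈ D, f x = g x) : IntegrableOn f D := by
  refine IntegrableOn.congr_fun ?_ (fun x hx => (hfg x hx).symm) hDo.measurableSet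
  exact (hg.integrableOn_compact hDb.isCompact_closure).mono_set subset_closure

/-- The divergence theorem on an arbitrary bounded open set, for functions vanishing at the
boundary. -/
theorem setIntegral_partialDeriv_eq_zero {d : ℕ} {D : Set (E d)} (hDo : IsOpen D)
    (hDb : Bornology.IsBounded D) {h : E d → ℝ} (hh : ContDiffOn ℝ 1 h (closure D))
    (h0 : ∀ x ∈ frontier D, h x = 0) (j : Fin d) : ∫ x in D, partialDeriv j h x = 0 := by
  obtain ⟨h', hc, hd⟩ := exists_contDiffOn_hasFDerivWithinAt (n := 0) (by simpa using hh)
    subset_closure subset_rfl hDo.uniqueDiffOn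
  have hda : ∀ x ∈ D, HasFDerivAt h (h' x) x := fun x hx =>
    (hd x (subset_closure hx)).hasFDerivAt (mem_of_superset (hDo.mem_nhds hx) subset_closure)
  obtain ⟨K, hK⟩ := hDb.isCompact_closure.exists_bound_of_continuousOn hc.continuousOn
  have hlip := lipschitzWith_indicator hDo (K := K.toNNReal) hh.continuousOn h0
    (fun x hx => (hda x hx).differentiableAt) (fun x hx => by
      rw [(hda x hx).fderiv, ← NNReal.coe_le_coe, coe_nnnorm]
      exact (hK x (subset_closure hx)).trans (Real.le_coe_toNNReal K))
  set G := D.indicator h with hG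
  have hsupp : HasCompactSupport G :=
    HasCompactSupport.intro hDb.isCompact_closure fun x hx =>
      indicator_of_notMem (fun h => hx (subset_closure h)) _
  set v : E d := EuclideanSpace.single j 1
  -- Testing `G` against the constant `1` gives a zero integral for its line derivative. The
  -- direction is `-v` because the integration by parts reverses it on the side of `G`.
  have hint := LipschitzWith.integral_lineDeriv_mul_eq (μ := volume)
    (LipschitzWith.const (1 : ℝ) : LipschitzWith 0 (fun _ : E d => (1 : ℝ))) hlip hsupp (-v)
  have hconst : ∀ x : E d, lineDeriv ℝ (fun _ : E d => (1:ℝ)) x (-v) = 0 := by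
    intro x; simp [lineDeriv]
  simp only [hconst, zero_mul, integral_zero, neg_neg, mul_one] at hint
  rw [hint, ← integral_indicator hDo.measurableSet]
  refine integral_congr_ae ?_
  -- Off `D` the function `G` is zero, so its derivative is zero almost everywhere there, the
  -- frontier included.
  filter_upwards [hlip.ae_fderiv_eq_zero_of_eq_zero, hlip.ae_differentiableAt] with x hx hx'
  rw [hx'.lineDeriv_eq_fderiv]
  by_cases hxD : x ∈ D
  · have : G =ᶠ[𝓝 x] h := by
      filter_upwards [hDo.mem_nhds hxD] with y hy using indicator_of_mem hy _
    rw [indicator_of_mem hxD, partialDeriv, this.fderiv_eq]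
  · rw [indicator_of_notMem hxD, hx (indicator_of_notMem hxD _)]; simp

/-- Integration by parts against a function vanishing at the boundary. -/
theorem setIntegral_mul_partialDeriv {d : ℕ} {D : Set (E d)} (hDo : IsOpen D)
    (hDb : Bornology.IsBounded D) {f g : E d → ℝ} (hf : ContDiffOn ℝ 1 f (closure D))
    (hg : ContDiffOn ℝ 1 g (closure D)) (h0 : ∀ x ∈ frontier D, f x = 0) (j : Fin d) :
    ∫ x in D, f x * partialDeriv j g x = -∫ x in D, partialDeriv j f x * g x := by
  have hprod := setIntegral_partialDeriv_eq_zero hDo hDb (hf.mul hg)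
    (fun x hx => by simp [h0 x hx]) j
  have hda : ∀ {h : E d → ℝ}, ContDiffOn ℝ 1 h (closure D) → ∀ x ∈ D, DifferentiableAt ℝ h x :=
    fun hh x hx => (hh.differentiableOn one_ne_zero).differentiableAt
      (mem_of_superset (hDo.mem_nhds hx) subset_closure)
  have heq : ∀ x ∈ D, partialDeriv j (f * g) x =
      f x * partialDeriv j g x + partialDeriv j f x * g x := by
    intro x hx
    rw [partialDeriv, fderiv_mul (hda hf x hx) (hda hg x hx)]
    simp [partialDeriv, mul_comm]
  obtain ⟨f', hf', hff'⟩ := exists_continuousOn_partialDeriv hDo hf j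
  obtain ⟨g', hg', hgg'⟩ := exists_continuousOn_partialDeriv hDo hg j
  have h1 := setIntegral_congr_fun (μ := volume) hDo.measurableSet heq
  have h2 := h1.symm.trans hprod
  rw [integral_add] at h2
  · linarith
  · exact integrableOn_of_eqOn_continuousOn_closure hDo hDb (hf.continuousOn.mul hg')
      fun x hx => by rw [hgg' x hx]; rfl
  · exact integrableOn_of_eqOn_continuousOn_closure hDo hDb (hf'.mul hg.continuousOn)
      fun x hx => by rw [hff' x hx]; rfl

/-! ### Integrals over `D` depending on time. -/

section Parametric

variable {d : ℕ} {D : Set (E d)} {T : ℝ}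

theorem continuousOn_slice {Y : Type*} [TopologicalSpace Y] {f : ℝ × E d → Y}
    (hf : ContinuousOn f (Ico 0 T ×ˢ closure D)) {t : ℝ} (ht : t ∈ Ico 0 T) :
    ContinuousOn (fun x => f (t, x)) (closure D) :=
  hf.comp (by fun_prop) fun _ hx => ⟨ht, hx⟩

theorem contDiffOn_slice {Y : Type*} [NormedAddCommGroup Y] [NormedSpace ℝ Y] {f : ℝ × E d → Y}
    {n : WithTop ℕ∞} (hf : ContDiffOn ℝ n f (Ico 0 T ×ˢ closure D)) {t : ℝ} (ht : t ∈ Ico 0 T) :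
    ContDiffOn ℝ n (fun x => f (t, x)) (closure D) :=
  hf.comp (by fun_prop) fun _ hx => ⟨ht, hx⟩

theorem exists_bound_of_continuousOn_prod {Y : Type*} [NormedAddCommGroup Y] {f : ℝ × E d → Y}
    (hDb : Bornology.IsBounded D) (hf : ContinuousOn f (Ico 0 T ×ˢ closure D)) {t : ℝ}
    (ht : t < T) : ∃ C, ∀ s ∈ Icc 0 t, ∀ x ∈ closure D, ‖f (s, x)‖ ≤ C := by
  obtain ⟨C, hC⟩ := (isCompact_Icc.prod hDb.isCompact_closure).exists_bound_of_continuousOn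
    (hf.mono (prod_mono (fun s (hs : s ∈ Icc 0 t) => ⟨hs.1, hs.2.trans_lt ht⟩) subset_rfl))
  exact ⟨C, fun s hs x hx => hC (s, x) ⟨hs, hx⟩⟩

theorem continuousOn_setIntegral (hDb : Bornology.IsBounded D) {f : ℝ × E d → ℝ}
    (hDo : IsOpen D) (hf : ContinuousOn f (Ico 0 T ×ˢ closure D)) :
    ContinuousOn (fun t => ∫ x in D, f (t, x)) (Ico 0 T) := by
  intro t ht
  obtain ⟨t₁, ht₁, ht₁T⟩ := exists_between ht.2
  obtain ⟨C, hC⟩ := exists_bound_of_continuousOn_prod hDb hf ht₁T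
  have hfin : volume D ≠ ⊤ := hDb.measure_lt_top.ne
  refine continuousWithinAt_of_dominated (bound := fun _ => C) ?_ ?_ ?_ ?_
  · filter_upwards [self_mem_nhdsWithin] with s hs
    exact ((continuousOn_slice hf hs).mono subset_closure).aestronglyMeasurable hDo.measurableSet
  · filter_upwards [self_mem_nhdsWithin, nhdsWithin_le_nhds (Iio_mem_nhds ht₁)] with s hs hs'
    filter_upwards [ae_restrict_mem hDo.measurableSet] with x hx
    exact hC s ⟨hs.1, le_of_lt hs'⟩ x (subset_closure hx)
  · exact integrableOn_const hfin
  · filter_upwards [ae_restrict_mem hDo.measurableSet] with x hx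
    exact (hf (t, x) ⟨ht, subset_closure hx⟩).comp (f := fun s : ℝ => (s, x))
      (by fun_prop) (fun s hs => mk_mem_prod hs (subset_closure hx))

theorem hasDerivWithinAt_time {Y : Type*} [NormedAddCommGroup Y] [NormedSpace ℝ Y]
    {f : ℝ × E d → Y} {L : ℝ × E d →L[ℝ] Y} {t : ℝ} {x : E d}
    (hx : x ∈ closure D) (hL : HasFDerivWithinAt f L (Ico 0 T ×ˢ closure D) (t, x)) :
    HasDerivWithinAt (fun s => f (s, x)) (L (1, 0)) (Ico 0 T) t := by
  have h1 : HasDerivWithinAt (fun s : ℝ => (s, x)) ((1 : ℝ), (0 : E d)) (Ico 0 T) t :=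
    ((hasDerivAt_id t).prodMk (hasDerivAt_const t x)).hasDerivWithinAt
  exact hL.comp_hasDerivWithinAt t h1 (fun s hs => mk_mem_prod hs hx)

theorem hasFDerivWithinAt_space {Y : Type*} [NormedAddCommGroup Y] [NormedSpace ℝ Y]
    {f : ℝ × E d → Y} {L : ℝ × E d →L[ℝ] Y} {t : ℝ} {x : E d}
    (ht : t ∈ Ico 0 T) (hL : HasFDerivWithinAt f L (Ico 0 T ×ˢ closure D) (t, x)) :
    HasFDerivWithinAt (fun y => f (t, y)) (L.comp (ContinuousLinearMap.inr ℝ ℝ (E d)))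
      (closure D) x :=
  hL.comp x (hasFDerivAt_prodMk_right t x).hasFDerivWithinAt (fun _ hy => mk_mem_prod ht hy)

theorem hasDerivAt_setIntegral (hDb : Bornology.IsBounded D) (hDo : IsOpen D) {f : ℝ × E d → ℝ}
    {f' : ℝ × E d → ℝ × E d →L[ℝ] ℝ} (hc : ContinuousOn f (Ico 0 T ×ˢ closure D))
    (hf'c : ContinuousOn f' (Ico 0 T ×ˢ closure D))
    (hf : ∀ z ∈ Ico 0 T ×ˢ closure D, HasFDerivWithinAt f (f' z) (Ico 0 T ×ˢ closure D) z)
    {t : ℝ} (ht : t ∈ Ioo 0 T) :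
    HasDerivAt (fun s => ∫ x in D, f (s, x)) (∫ x in D, f' (t, x) (1, 0)) t := by
  obtain ⟨t₁, ht₁, ht₁T⟩ := exists_between ht.2
  have hf'1 : ContinuousOn (fun z => f' z (1, 0)) (Ico 0 T ×ˢ closure D) :=
    hf'c.clm_apply continuousOn_const
  obtain ⟨C, hC⟩ := exists_bound_of_continuousOn_prod hDb hf'1 ht₁T
  have hfin : volume D ≠ ⊤ := hDb.measure_lt_top.ne
  have ht' : t ∈ Ico 0 T := ⟨ht.1.le, ht.2⟩
  have hmeas : ∀ {g : ℝ × E d → ℝ}, ContinuousOn g (Ico 0 T ×ˢ closure D) → ∀ s ∈ Ico 0 T,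
      AEStronglyMeasurable (fun x => g (s, x)) (volume.restrict D) := fun hg s hs =>
    ((continuousOn_slice hg hs).mono subset_closure).aestronglyMeasurable hDo.measurableSet
  refine (hasDerivAt_integral_of_dominated_loc_of_deriv_le (bound := fun _ => C)
    (F := fun s x => f (s, x)) (F' := fun s x => f' (s, x) (1, 0))
    (Ioo_mem_nhds ht.1 ht₁) ?_ ?_ (hmeas hf'1 t ht') ?_ (integrableOn_const hfin) ?_).2
  · filter_upwards [Ioo_mem_nhds ht.1 ht.2] with s hs using hmeas hc s ⟨hs.1.le, hs.2⟩
  · exact integrableOn_of_eqOn_continuousOn_closure hDo hDb (continuousOn_slice hc ht')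
      fun x _ => rfl
  · filter_upwards [ae_restrict_mem hDo.measurableSet] with x hx s hs
    exact hC s ⟨hs.1.le, hs.2.le⟩ x (subset_closure hx)
  · filter_upwards [ae_restrict_mem hDo.measurableSet] with x hx s hs
    have hs' : s ∈ Ioo 0 T := ⟨hs.1, hs.2.trans ht₁T⟩
    exact (hasDerivWithinAt_time (subset_closure hx) (hf (s, x) ⟨⟨hs'.1.le, hs'.2⟩,
      subset_closure hx⟩)).hasDerivAt (Ico_mem_nhds hs'.1 hs'.2)

end Parametric

/-! ### The maximum principle for transported families. -/

theorem HasDerivAt.nonneg_of_left_le {f : ℝ → ℝ} {f' t : ℝ} (hf : HasDerivAt f f' t)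
    (h : ∀ᶠ s in 𝓝[<] t, f s ≤ f t) : 0 ≤ f' := by
  have h1 := (hasDerivWithinAt_iff_tendsto_slope' (self_notMem_Iio (a := t))).1
    (hf.hasDerivWithinAt (s := Iio t))
  refine ge_of_tendsto h1 ?_
  filter_upwards [h, self_mem_nhdsWithin] with s hs hs'
  rw [slope_def_field]
  exact div_nonneg_of_nonpos (by linarith) (sub_nonpos.2 (le_of_lt hs'))

/-- A maximum principle for families of functions transported by a velocity vanishing at the
boundary: if no member can touch `0` from below unless its material derivative is negative, all
members stay negative. -/
theorem transport_max_principle {V : Type*} [TopologicalSpace V] [T2Space V] {W : Set V}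
    (hW : IsCompact W) {d : ℕ} {D : Set (E d)} {T : ℝ} (hDo : IsOpen D)
    (hDb : Bornology.IsBounded D) {u : ℝ → E d → E d}
    (hu : ∀ t ∈ Ico 0 T, ∀ x ∈ frontier D, u t x = 0)
    {φ : V → ℝ × E d → ℝ} {φ' : V → ℝ × E d → ℝ × E d →L[ℝ] ℝ}
    (hc : ContinuousOn (fun q : V × (ℝ × E d) => φ q.1 q.2) (W ×ˢ (Ico 0 T ×ˢ closure D)))
    (hd : ∀ v ∈ W, ∀ z ∈ Ico 0 T ×ˢ closure D,
      HasFDerivWithinAt (φ v) (φ' v z) (Ico 0 T ×ˢ closure D) z)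
    (h0 : ∀ v ∈ W, ∀ x ∈ closure D, φ v (0, x) < 0) {t₁ : ℝ} (ht₁ : t₁ < T)
    (h : ∀ t ∈ Ioc 0 t₁, ∀ v ∈ W, ∀ x ∈ closure D, φ v (t, x) = 0 →
      (∀ w ∈ W, ∀ y ∈ closure D, φ w (t, y) ≤ 0) → φ' v (t, x) (1, u t x) < 0) :
    ∀ t ∈ Icc 0 t₁, ∀ v ∈ W, ∀ x ∈ closure D, φ v (t, x) < 0 := by
  by_contra! hcon
  obtain ⟨t₂, ht₂, v₂, hv₂, x₂, hx₂, hφ₂⟩ := hcon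
  set K : Set (V × (ℝ × E d)) := W ×ˢ (Icc 0 t₁ ×ˢ closure D)
  have hK : IsCompact K := hW.prod (isCompact_Icc.prod hDb.isCompact_closure)
  have hKS : K ⊆ W ×ˢ (Ico 0 T ×ˢ closure D) :=
    prod_mono subset_rfl (prod_mono (fun s hs => ⟨hs.1, hs.2.trans_lt ht₁⟩) subset_rfl)
  set B := K ∩ (fun q : V × (ℝ × E d) => φ q.1 q.2) ⁻¹' Ici 0
  have hB : IsCompact B := hK.of_isClosed_subset
    ((hc.mono hKS).preimage_isClosed_of_isClosed hK.isClosed isClosed_Ici) inter_subset_left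
  -- The set `B` of violations is compact, so there is one at the earliest possible time `t`. Before
  -- `t` every member of the family is negative.
  obtain ⟨⟨v, t, x⟩, ⟨⟨hv, ht, hx⟩, hφ⟩, hmin⟩ := hB.exists_isMinOn
    ⟨(v₂, t₂, x₂), ⟨⟨hv₂, ht₂, hx₂⟩, hφ₂⟩⟩
    (f := fun q => q.2.1) (by fun_prop)
  simp only at hv ht hx
  replace hφ : 0 ≤ φ v (t, x) := hφ
  have hbefore : ∀ s ∈ Ico 0 t, ∀ w ∈ W, ∀ y ∈ closure D, φ w (s, y) < 0 := by
    intro s hs w hw y hy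
    by_contra! hcon
    exact absurd (hmin (show (w, s, y) ∈ B from
      ⟨⟨hw, ⟨hs.1, hs.2.le.trans ht.2⟩, hy⟩, hcon⟩)) (not_le.2 hs.2)
  have htpos : 0 < t := by
    rcases ht.1.lt_or_eq with h | h
    · exact h
    · subst h; exact absurd (h0 v hv x hx) (not_lt.2 hφ)
  have htT : t < T := ht.2.trans_lt ht₁
  have hlt : ∀ᶠ s in 𝓝[<] t, s ∈ Ico 0 t := by
    filter_upwards [nhdsWithin_le_nhds (Ioi_mem_nhds htpos), self_mem_nhdsWithin] with s hs hs'
    exact ⟨le_of_lt hs, hs'⟩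
  have htime : ∀ w ∈ W, ∀ y ∈ closure D,
      HasDerivAt (fun s => φ w (s, y)) (φ' w (t, y) (1, 0)) t := fun w hw y hy =>
    (hasDerivWithinAt_time hy (hd w hw (t, y) ⟨⟨htpos.le, htT⟩, hy⟩)).hasDerivAt
      (Ico_mem_nhds htpos htT)
  have hle : ∀ w ∈ W, ∀ y ∈ closure D, φ w (t, y) ≤ 0 := by
    intro w hw y hy
    refine le_of_tendsto ((htime w hw y hy).continuousAt.tendsto.mono_left
      (nhdsWithin_le_nhds (s := Iio t))) ?_
    filter_upwards [hlt] with s hs using (hbefore s hs w hw y hy).le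
  have heq : φ v (t, x) = 0 := le_antisymm (hle v hv x hx) hφ
  have hneg := h t ⟨htpos, ht.2⟩ v hv x hx heq hle
  have h1 : 0 ≤ φ' v (t, x) (1, 0) := by
    refine HasDerivAt.nonneg_of_left_le (htime v hv x hx) ?_
    filter_upwards [hlt] with s hs
    rw [heq]; exact (hbefore s hs v hv x hx).le
  -- The convective part vanishes: inside `D` the point `x` is a spatial maximum, and on the
  -- frontier `u = 0`. The material derivative thus equals the time derivative, which is nonnegative
  -- at a first touching time.
  have h2 : φ' v (t, x) (0, u t x) = 0 := by
    by_cases hxD : x ∈ D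
    · have hsp := (hasFDerivWithinAt_space ⟨htpos.le, htT⟩
        (hd v hv (t, x) ⟨⟨htpos.le, htT⟩, hx⟩)).hasFDerivAt
        (mem_of_superset (hDo.mem_nhds hxD) subset_closure)
      have hmax : IsLocalMax (fun y => φ v (t, y)) x := by
        filter_upwards [hDo.mem_nhds hxD] with y hy
        rw [heq]; exact hle v hv y (subset_closure hy)
      have := congrArg (fun L : E d →L[ℝ] ℝ => L (u t x)) (hmax.hasFDerivAt_eq_zero hsp)
      simpa using this
    · rw [hu t ⟨htpos.le, htT⟩ x ⟨hx, by rwa [hDo.interior_eq]⟩]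
      exact map_zero _
  have h3 : φ' v (t, x) (1, u t x) = φ' v (t, x) (1, 0) + φ' v (t, x) (0, u t x) := by
    rw [← map_add]; simp
  linarith

/-! ### Boundary derivatives and the conformation equation up to the boundary. -/

/-- The spatial gradient matrix read off from a space-time derivative. -/
def spaceGrad {d : ℕ} (L : ℝ × E d →L[ℝ] E d) : Matrix (Fin d) (Fin d) ℝ :=
  Matrix.of fun i j => L (0, EuclideanSpace.single j 1) i

/-- Space-time derivatives of velocity and conformation tensor, continuous up to the boundary. -/
structure BoundaryDerivatives {d : ℕ} (T : ℝ) (D : Set (E d)) (u : ℝ → E d → E d)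
    (A : ℝ → E d → Matrix (Fin d) (Fin d) ℝ) (u' : ℝ × E d → ℝ × E d →L[ℝ] E d)
    (A' : Fin d → Fin d → ℝ × E d → ℝ × E d →L[ℝ] ℝ) : Prop where
  velocity_continuousOn : ContinuousOn u' (Ico 0 T ×ˢ closure D)
  velocity_hasFDerivWithinAt : ∀ z ∈ Ico 0 T ×ˢ closure D,
    HasFDerivWithinAt (fun z : ℝ × E d => u z.1 z.2) (u' z) (Ico 0 T ×ˢ closure D) z
  conformation_continuousOn : ∀ i j, ContinuousOn (A' i j) (Ico 0 T ×ˢ closure D)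
  conformation_hasFDerivWithinAt : ∀ i j, ∀ z ∈ Ico 0 T ×ˢ closure D,
    HasFDerivWithinAt (fun z : ℝ × E d => A z.1 z.2 i j) (A' i j z) (Ico 0 T ×ˢ closure D) z

theorem exists_space_time_derivative {d : ℕ} {D : Set (E d)} {T : ℝ} (hDo : IsOpen D) {Y : Type*}
    [NormedAddCommGroup Y] [NormedSpace ℝ Y] {f : ℝ × E d → Y}
    (hf : ContDiffOn ℝ 1 f (Ico 0 T ×ˢ closure D)) :
    ∃ f' : ℝ × E d → ℝ × E d →L[ℝ] Y, ContinuousOn f' (Ico 0 T ×ˢ closure D) ∧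
      ∀ z ∈ Ico 0 T ×ˢ closure D, HasFDerivWithinAt f (f' z) (Ico 0 T ×ˢ closure D) z := by
  obtain ⟨f', h1, h2⟩ := exists_contDiffOn_hasFDerivWithinAt (n := 0) (S₀ := Ico 0 T ×ˢ D)
    (by simpa using hf) (prod_mono subset_rfl subset_closure)
    (by rw [closure_prod_eq]; exact prod_mono subset_closure subset_rfl)
    ((uniqueDiffOn_Ico 0 T).prod hDo.uniqueDiffOn)
  exact ⟨f', h1.continuousOn, h2⟩

section Solution

variable {d : ℕ} {Re We ε b T : ℝ} {D : Set (E d)} {u : ℝ → E d → E d} {p : ℝ → E d → ℝ}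
  {A : ℝ → E d → Matrix (Fin d) (Fin d) ℝ} {u' : ℝ × E d → ℝ × E d →L[ℝ] E d}
  {A' : Fin d → Fin d → ℝ × E d → ℝ × E d →L[ℝ] ℝ}

theorem IsRegularSolution.exists_boundaryDerivatives
    (hsol : IsRegularSolution Re We ε b T D u p A) (hDo : IsOpen D) :
    ∃ u' A', BoundaryDerivatives T D u A u' A' := by
  obtain ⟨u', h1, h2⟩ := exists_space_time_derivative hDo hsol.velocity_regular
  choose A' h3 h4 using fun i j => exists_space_time_derivative hDo (hsol.conformation_regular i j)
  exact ⟨u', A', h1, h2, h3, h4⟩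

theorem BoundaryDerivatives.spaceGrad_continuousOn (h : BoundaryDerivatives T D u A u' A') :
    ContinuousOn (fun z => spaceGrad (u' z)) (Ico 0 T ×ˢ closure D) := by
  refine continuousOn_pi.2 fun i => continuousOn_pi.2 fun j => ?_
  have h1 : ContinuousOn (fun z => u' z (0, EuclideanSpace.single j 1)) (Ico 0 T ×ˢ closure D) :=
    h.velocity_continuousOn.clm_apply continuousOn_const
  exact (EuclideanSpace.proj (𝕜 := ℝ) i).continuous.comp_continuousOn h1

theorem IsRegularSolution.conformation_continuousOn
    (hsol : IsRegularSolution Re We ε b T D u p A) :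
    ContinuousOn (fun z : ℝ × E d => A z.1 z.2) (Ico 0 T ×ˢ closure D) :=
  continuousOn_pi.2 fun i => continuousOn_pi.2 fun j => (hsol.conformation_regular i j).continuousOn

theorem BoundaryDerivatives.gradMat_eq (h : BoundaryDerivatives T D u A u' A') (hDo : IsOpen D)
    {t : ℝ} (ht : t ∈ Ico 0 T) {x : E d} (hx : x ∈ D) :
    gradMat (u t) x = spaceGrad (u' (t, x)) := by
  ext i j
  have h1 := hasFDerivWithinAt_space ht
    (h.velocity_hasFDerivWithinAt (t, x) ⟨ht, subset_closure hx⟩)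
  have h2 := (EuclideanSpace.proj (𝕜 := ℝ) i).hasFDerivAt.comp_hasFDerivWithinAt x h1
  simp only [gradMat, Matrix.of_apply, spaceGrad]
  exact partialDeriv_eq_of_hasFDerivWithinAt hDo hx h2 j

theorem continuous_springFactor :
    Continuous (springFactor b : Matrix (Fin d) (Fin d) ℝ → ℝ) := by
  unfold springFactor; fun_prop

/-- The right-hand side of the equation for the conformation tensor. -/
def conformationRate (We b : ℝ) (L M : Matrix (Fin d) (Fin d) ℝ) : Matrix (Fin d) (Fin d) ℝ :=
  L * M + M * L.transpose - (1 / We) • ((springFactor b M)⁻¹ • M)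
    + (1 / We) • (1 : Matrix (Fin d) (Fin d) ℝ)

theorem BoundaryDerivatives.material_derivative_interior
    (h : BoundaryDerivatives T D u A u' A')
    (hsol : IsRegularSolution Re We ε b T D u p A) (hDo : IsOpen D)
    {t : ℝ} (ht : t ∈ Ioo 0 T) {x : E d} (hx : x ∈ D) (i j : Fin d) :
    A' i j (t, x) (1, u t x) = conformationRate We b (spaceGrad (u' (t, x))) (A t x) i j := by
  have ht' : t ∈ Ico 0 T := ⟨ht.1.le, ht.2⟩
  have hd := h.conformation_hasFDerivWithinAt i j (t, x) ⟨ht', subset_closure hx⟩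
  have h1 := (hasDerivWithinAt_time (subset_closure hx) hd).hasDerivAt
    (Ico_mem_nhds ht.1 ht.2)
  have h2 := (hasFDerivWithinAt_space ht' hd).hasFDerivAt
        (mem_of_superset (hDo.mem_nhds hx) subset_closure)
  have h3 := hsol.conformation t ht x hx i j
  rw [h1.deriv, h2.fderiv, h.gradMat_eq hDo ht' hx] at h3
  rw [conformationRate, ← h3]
  simp [← map_add]

theorem continuousAt_conformationRate {L M : Matrix (Fin d) (Fin d) ℝ} (hM : springFactor b M ≠ 0) :
    ContinuousAt (fun q : Matrix (Fin d) (Fin d) ℝ × Matrix (Fin d) (Fin d) ℝ =>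
      conformationRate We b q.1 q.2) (L, M) := by
  unfold conformationRate
  have h1 : ContinuousAt (fun q : Matrix (Fin d) (Fin d) ℝ × Matrix (Fin d) (Fin d) ℝ =>
      (springFactor b q.2)⁻¹) (L, M) :=
    ContinuousAt.inv₀ (continuous_springFactor.comp continuous_snd).continuousAt hM
  have h2 : Continuous (fun q : Matrix (Fin d) (Fin d) ℝ × Matrix (Fin d) (Fin d) ℝ =>
      q.1 * q.2 + q.2 * q.1.transpose) :=
    (continuous_fst.matrix_mul continuous_snd).add
      (continuous_snd.matrix_mul continuous_fst.matrix_transpose)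
  exact (h2.continuousAt.sub ((h1.smul continuousAt_snd).const_smul (1 / We))).add continuousAt_const

/-- The equation is given on `(0, T) × D` only. Both sides extend continuously to `[0, T) × closure
D` wherever the spring factor is nonzero, and the open set is dense. The maximum principle needs
this at frontier points. -/
theorem BoundaryDerivatives.material_derivative
    (h : BoundaryDerivatives T D u A u' A')
    (hsol : IsRegularSolution Re We ε b T D u p A) (hDo : IsOpen D)
    {t : ℝ} (ht : t ∈ Ico 0 T) {x : E d} (hx : x ∈ closure D) (hs : springFactor b (A t x) ≠ 0)
    (i j : Fin d) :
    A' i j (t, x) (1, u t x) = conformationRate We b (spaceGrad (u' (t, x))) (A t x) i j := by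
  have hsub : Ioo 0 T ×ˢ D ⊆ Ico 0 T ×ˢ closure D := prod_mono Ioo_subset_Ico_self subset_closure
  have hz : (t, x) ∈ Ico 0 T ×ˢ closure D := ⟨ht, hx⟩
  have hcl : (t, x) ∈ closure (Ioo 0 T ×ˢ D) := by
    rw [closure_prod_eq, closure_Ioo (ht.1.trans_lt ht.2).ne]
    exact ⟨⟨ht.1, ht.2.le⟩, hx⟩
  have hne := mem_closure_iff_nhdsWithin_neBot.1 hcl
  have h1 : ContinuousWithinAt (fun z : ℝ × E d => A' i j z (1, u z.1 z.2))
      (Ico 0 T ×ˢ closure D) (t, x) :=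
    (h.conformation_continuousOn i j _ hz).clm_apply
      (continuousWithinAt_const.prodMk (hsol.velocity_regular.continuousOn _ hz))
  have h2 : ContinuousWithinAt (fun z : ℝ × E d => conformationRate We b (spaceGrad (u' z))
      (A z.1 z.2) i j) (Ico 0 T ×ˢ closure D) (t, x) := by
    have h3 := (continuousAt_conformationRate (We := We) (L := spaceGrad (u' (t, x)))
      hs).comp_continuousWithinAt (f := fun z : ℝ × E d => (spaceGrad (u' z), A z.1 z.2))
      ((h.spaceGrad_continuousOn _ hz).prodMk (hsol.conformation_continuousOn _ hz))
    exact continuousWithinAt_pi.1 (continuousWithinAt_pi.1 h3 i) j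
  refine tendsto_nhds_unique_of_eventuallyEq (h1.mono hsub) (h2.mono hsub) ?_
  filter_upwards [self_mem_nhdsWithin] with z hz'
  exact h.material_derivative_interior hsol hDo hz'.1 hz'.2 i j

end Solution

/-! ### Persistence of the trace bound and of symmetry. -/

section Positivity

variable {d : ℕ} {Re We ε b T : ℝ} {D : Set (E d)} {u : ℝ → E d → E d} {p : ℝ → E d → ℝ}
  {A : ℝ → E d → Matrix (Fin d) (Fin d) ℝ} {u' : ℝ × E d → ℝ × E d →L[ℝ] E d}
  {A' : Fin d → Fin d → ℝ × E d → ℝ × E d →L[ℝ] ℝ}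

theorem trace_conformationRate (L M : Matrix (Fin d) (Fin d) ℝ) :
    (conformationRate We b L M).trace =
      (L * M + M * L.transpose).trace - (1 / We) * ((springFactor b M)⁻¹ * M.trace)
        + (1 / We) * d := by
  simp [conformationRate, Matrix.trace_add, Matrix.trace_sub, Matrix.trace_smul]

/-- If `tr A` reaches `b (1 - s₀)`, the spring factor equals `s₀` and relaxation contributes `-b (1
- s₀) / (We s₀)`. For small `s₀` this beats the stretching term, which is bounded on `[0, t₁]`
independently of `s₀`. The uniform gap `s₀` is reused for positive definiteness. -/
theorem BoundaryDerivatives.springFactor_lower_bound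
    (h : BoundaryDerivatives T D u A u' A') (hsol : IsRegularSolution Re We ε b T D u p A)
    (hWe : 0 < We) (hb : 0 < b) (hDo : IsOpen D) (hDb : Bornology.IsBounded D)
    (htr₀ : ∀ x ∈ closure D, (A 0 x).trace < b) {t₁ : ℝ} (ht₁ : t₁ ∈ Ico 0 T) :
    ∃ s₀ > 0, ∀ t ∈ Icc 0 t₁, ∀ x ∈ closure D, s₀ < springFactor b (A t x) := by
  have hcA := hsol.conformation_continuousOn
  have h0T : (0 : ℝ) ∈ Ico 0 T := ⟨le_rfl, ht₁.1.trans_lt ht₁.2⟩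
  obtain ⟨m, hm, hmb⟩ : ∃ m > 0, ∀ x ∈ closure D, m < springFactor b (A 0 x) := by
    rcases (closure D).eq_empty_or_nonempty with he | hne
    · exact ⟨1, one_pos, by simp [he]⟩
    · have hc : ContinuousOn (fun x => springFactor b (A 0 x)) (closure D) :=
        continuous_springFactor.comp_continuousOn (continuousOn_slice hcA h0T)
      obtain ⟨x₀, hx₀, hmin⟩ := hDb.isCompact_closure.exists_isMinOn hne hc
      have hpos : 0 < springFactor b (A 0 x₀) := by
        have := (div_lt_one hb).2 (htr₀ x₀ hx₀)
        unfold springFactor; linarith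
      exact ⟨springFactor b (A 0 x₀) / 2, by positivity, fun x hx =>
        (half_lt_self hpos).trans_le (hmin hx)⟩
  have hcg : ContinuousOn (fun z : ℝ × E d => (spaceGrad (u' z) * A z.1 z.2
      + A z.1 z.2 * (spaceGrad (u' z)).transpose).trace) (Ico 0 T ×ˢ closure D) := by
    have h3 : Continuous (fun q : Matrix (Fin d) (Fin d) ℝ × Matrix (Fin d) (Fin d) ℝ =>
        (q.1 * q.2 + q.2 * q.1.transpose).trace) :=
      ((continuous_fst.matrix_mul continuous_snd).add
        (continuous_snd.matrix_mul continuous_fst.matrix_transpose)).matrix_trace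
    exact h3.comp_continuousOn (f := fun z : ℝ × E d => (spaceGrad (u' z), A z.1 z.2))
      (h.spaceGrad_continuousOn.prodMk hcA)
  obtain ⟨M, hM⟩ := exists_bound_of_continuousOn_prod hDb hcg ht₁.2
  -- `C / We` bounds stretching plus source, with `1 / We` to spare for strictness. The bounds `s₀ ≤
  -- 1/2` and `2 C s₀ ≤ b` give `C s₀ ≤ b (1 - s₀)`, and `s₀ ≤ m` handles the initial time.
  set C : ℝ := We * |M| + d + 1 with hC
  have hCpos : 0 < C := by positivity
  set s₀ : ℝ := min (1 / 2) (min m (b / (2 * C))) with hs₀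
  have hs₀pos : 0 < s₀ := lt_min (by norm_num) (lt_min hm (by positivity))
  have hs₀1 : s₀ ≤ 1 / 2 := min_le_left _ _
  have hs₀m : s₀ ≤ m := (min_le_right _ _).trans (min_le_left _ _)
  have hs₀C : s₀ * (2 * C) ≤ b :=
    (le_div_iff₀ (by positivity)).1 ((min_le_right _ _).trans (min_le_right _ _))
  refine ⟨s₀, hs₀pos, ?_⟩
  have hmax := transport_max_principle (V := Unit) (W := univ) isCompact_univ hDo hDb
    hsol.no_slip (φ := fun _ z => (∑ i, A z.1 z.2 i i) - b * (1 - s₀))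
    (φ' := fun _ z => ∑ i, A' i i z) ?_ ?_ ?_ ht₁.2 ?_
  · intro t ht x hx
    have := hmax t ht () trivial x hx
    have h2 : (A t x).trace < b * (1 - s₀) := by
      simp only [Matrix.trace, Matrix.diag_apply]; linarith
    have h3 : (A t x).trace / b < 1 - s₀ := by rw [div_lt_iff₀ hb]; linarith
    unfold springFactor; linarith
  · have h1 : ContinuousOn (fun z : ℝ × E d => (∑ i, A z.1 z.2 i i) - b * (1 - s₀))
        (Ico 0 T ×ˢ closure D) :=
      (continuousOn_finsetSum _ fun i _ => (hsol.conformation_regular i i).continuousOn).sub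
        continuousOn_const
    exact h1.comp (by fun_prop) fun q hq => hq.2
  · intro _ _ z hz
    exact (HasFDerivWithinAt.fun_sum fun i _ => h.conformation_hasFDerivWithinAt i i z hz).sub_const _
  · intro _ _ x hx
    have h1 := hmb x hx
    unfold springFactor at h1
    have h2 : (A 0 x).trace / b < 1 - s₀ := by linarith
    rw [div_lt_iff₀ hb] at h2
    simp only [Matrix.trace, Matrix.diag_apply] at h2
    simp only; linarith
  · intro t ht _ _ x hx hzero _
    have htr : (A t x).trace = b * (1 - s₀) := by
      simp only [Matrix.trace, Matrix.diag_apply]; linarith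
    have hsf : springFactor b (A t x) = s₀ := by
      unfold springFactor; rw [htr]; field_simp; ring
    have htT : t ∈ Ico 0 T := ⟨ht.1.le, ht.2.trans_lt ht₁.2⟩
    have hrate : (∑ i, A' i i (t, x)) (1, u t x) =
        (conformationRate We b (spaceGrad (u' (t, x))) (A t x)).trace := by
      simp only [sum_apply, Matrix.trace, Matrix.diag_apply]
      exact Finset.sum_congr rfl fun i _ =>
        h.material_derivative hsol hDo htT hx (by rw [hsf]; exact hs₀pos.ne') i i
    rw [hrate, trace_conformationRate, hsf, htr]
    have hMb := (le_abs_self _).trans ((hM t ⟨ht.1.le, ht.2⟩ x hx).trans (le_abs_self M))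
    have hkey : C ≤ s₀⁻¹ * (b * (1 - s₀)) := by
      rw [inv_mul_eq_div, le_div_iff₀ hs₀pos]
      nlinarith
    have h5 : (1 / We) * C ≤ (1 / We) * (s₀⁻¹ * (b * (1 - s₀))) :=
      mul_le_mul_of_nonneg_left hkey (by positivity)
    have h6 : (1 / We) * C = |M| + (1 / We) * d + 1 / We := by
      rw [hC]; field_simp
    have h7 : 0 < 1 / We := by positivity
    simp only at hMb ⊢
    linarith

/-- Young's inequality on each product `B i j * B k j`; summing over the free index yields the
factor `d`. It supplies the Grönwall constant for symmetry. -/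
theorem sum_mul_mul_le {C : ℝ} {L B : Matrix (Fin d) (Fin d) ℝ} (hL : ∀ i j, |L i j| ≤ C) :
    ∑ i, ∑ j, B i j * (L * B) i j ≤ C * d * ∑ i, ∑ j, B i j ^ 2 := by
  have h1 : ∀ i j k, B i j * (L i k * B k j) ≤ C / 2 * (B i j ^ 2 + B k j ^ 2) := by
    intro i j k
    have hC : 0 ≤ C := (abs_nonneg _).trans (hL i k)
    have h2 : |B i j * B k j| ≤ (B i j ^ 2 + B k j ^ 2) / 2 := by
      rw [abs_mul]
      nlinarith [sq_nonneg (|B i j| - |B k j|), sq_abs (B i j), sq_abs (B k j)]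
    calc B i j * (L i k * B k j) = L i k * (B i j * B k j) := by ring
      _ ≤ |L i k| * |B i j * B k j| := (le_abs_self _).trans (abs_mul _ _).le
      _ ≤ C * ((B i j ^ 2 + B k j ^ 2) / 2) := mul_le_mul (hL i k) h2 (abs_nonneg _) hC
      _ = _ := by ring
  calc ∑ i, ∑ j, B i j * (L * B) i j = ∑ i, ∑ j, ∑ k, B i j * (L i k * B k j) := by
        simp only [Matrix.mul_apply, Finset.mul_sum]
    _ ≤ ∑ i, ∑ j, ∑ k, C / 2 * (B i j ^ 2 + B k j ^ 2) := 
        Finset.sum_le_sum fun i _ => Finset.sum_le_sum fun j _ => Finset.sum_le_sum fun k _ =>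
          h1 i j k
    _ = C / 2 * (∑ i, ∑ j, ∑ _k : Fin d, B i j ^ 2) + C / 2 * ∑ _i : Fin d, ∑ j, ∑ k, B k j ^ 2 := by
        simp only [mul_add, Finset.sum_add_distrib, Finset.mul_sum]
    _ = _ := by
        simp only [Finset.sum_const, Finset.card_univ, Fintype.card_fin, nsmul_eq_mul,
          ← Finset.mul_sum]
        rw [Finset.sum_comm (f := fun j k => B k j ^ 2)]
        ring

theorem sum_mul_mul_transpose_le {C : ℝ} {L B : Matrix (Fin d) (Fin d) ℝ}
    (hL : ∀ i j, |L i j| ≤ C) :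
    ∑ i, ∑ j, B i j * (B * L.transpose) i j ≤ C * d * ∑ i, ∑ j, B i j ^ 2 := by
  have h1 := sum_mul_mul_le (B := B.transpose) hL
  rw [Finset.sum_comm] at h1
  rw [Finset.sum_comm (f := fun i j => B.transpose i j ^ 2)] at h1
  refine le_trans (le_of_eq ?_) h1
  refine Finset.sum_congr rfl fun i _ => Finset.sum_congr rfl fun j _ => ?_
  rw [← Matrix.transpose_apply (L * B.transpose), Matrix.transpose_mul, Matrix.transpose_transpose]
  rfl

theorem BoundaryDerivatives.exists_spaceGrad_bound
    (h : BoundaryDerivatives T D u A u' A') (hDb : Bornology.IsBounded D) {t₁ : ℝ} (ht₁ : t₁ < T) :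
    ∃ C, 0 ≤ C ∧ ∀ t ∈ Icc 0 t₁, ∀ x ∈ closure D, ∀ i j, |spaceGrad (u' (t, x)) i j| ≤ C := by
  choose C hC using fun i j => exists_bound_of_continuousOn_prod hDb
    (continuousOn_pi.1 (continuousOn_pi.1 h.spaceGrad_continuousOn i) j) ht₁
  refine ⟨∑ i, ∑ j, |C i j|, by positivity, fun t ht x hx i j => ?_⟩
  calc _ ≤ |C i j| := (hC i j t ht x hx).trans (le_abs_self _)
    _ ≤ ∑ j, |C i j| := Finset.single_le_sum (f := fun j => |C i j|)
        (fun _ _ => abs_nonneg _) (Finset.mem_univ j)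
    _ ≤ _ := Finset.single_le_sum (f := fun i => ∑ j, |C i j|) (fun _ _ => by positivity)
        (Finset.mem_univ i)

/-- The antisymmetric defect `B = A - Aᵀ` solves the linear homogeneous equation with rate `L B + B
Lᵀ - (1/We) s⁻¹ B`, where `s > 0` is the spring factor, and starts from zero. Grönwall's inequality
for its squared norm is run as a comparison with `δ exp(M t)`, with `δ` arbitrary. -/
theorem BoundaryDerivatives.isSymm
    (h : BoundaryDerivatives T D u A u' A') (hsol : IsRegularSolution Re We ε b T D u p A)
    (hWe : 0 < We) (hDo : IsOpen D) (hDb : Bornology.IsBounded D)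
    (hA₀ : ∀ x ∈ closure D, ∀ i j, A 0 x i j = A 0 x j i) {t₁ : ℝ} (ht₁ : t₁ ∈ Ico 0 T)
    (hs : ∀ t ∈ Icc 0 t₁, ∀ x ∈ closure D, 0 < springFactor b (A t x)) :
    ∀ t ∈ Icc 0 t₁, ∀ x ∈ closure D, ∀ i j, A t x i j = A t x j i := by
  obtain ⟨C, hC0, hC⟩ := h.exists_spaceGrad_bound hDb ht₁.2
  -- The two stretching terms contribute at most `2 C d` each to the growth rate of the squared
  -- norm, and relaxation only helps; the `1` makes the comparison strict.
  set M : ℝ := 4 * (C * d) + 1 with hM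
  have key : ∀ δ > 0, ∀ t ∈ Icc 0 t₁, ∀ x ∈ closure D,
      ∑ i, ∑ j, (A t x i j - A t x j i) ^ 2 < δ * Real.exp (M * t) := by
    intro δ hδ t ht x hx
    have hexpd : ∀ z : ℝ × E d, HasFDerivAt (fun z : ℝ × E d => δ * Real.exp (M * z.1))
        (δ • (Real.exp (M * z.1) • (M • ContinuousLinearMap.fst ℝ ℝ (E d)))) z := fun z =>
      ((hasFDerivAt_fst.const_mul M).exp).const_mul δ
    have hmax := transport_max_principle (V := Unit) (W := univ) isCompact_univ hDo hDb
      hsol.no_slip (φ := fun _ z => (∑ i, ∑ j, (A z.1 z.2 i j - A z.1 z.2 j i) ^ 2)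
        - δ * Real.exp (M * z.1))
      (φ' := fun _ z => (∑ i, ∑ j, ((2 * (A z.1 z.2 i j - A z.1 z.2 j i) ^ 1)) •
          (A' i j z - A' j i z))
        - δ • (Real.exp (M * z.1) • (M • ContinuousLinearMap.fst ℝ ℝ (E d)))) ?_ ?_ ?_ ht₁.2 ?_
    · have := hmax t ht () trivial x hx
      simp only at this
      linarith
    · have h1 : ContinuousOn (fun z : ℝ × E d => (∑ i, ∑ j, (A z.1 z.2 i j - A z.1 z.2 j i) ^ 2)
          - δ * Real.exp (M * z.1)) (Ico 0 T ×ˢ closure D) := by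
        refine ContinuousOn.sub (continuousOn_finsetSum _ fun i _ => continuousOn_finsetSum _
          fun j _ => ?_) (by fun_prop)
        exact ((hsol.conformation_regular i j).continuousOn.sub
          (hsol.conformation_regular j i).continuousOn).pow 2
      exact h1.comp (by fun_prop) fun q hq => hq.2
    · intro _ _ z hz
      refine HasFDerivWithinAt.sub ?_ (hexpd z).hasFDerivWithinAt
      refine HasFDerivWithinAt.fun_sum fun i _ => HasFDerivWithinAt.fun_sum fun j _ => ?_
      have := ((h.conformation_hasFDerivWithinAt i j z hz).sub
        (h.conformation_hasFDerivWithinAt j i z hz)).pow 2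
      simpa using this
    · intro _ _ x hx
      simp [hA₀ x hx _ _, hδ]
    · intro t ht _ _ x hx hzero _
      have htT : t ∈ Ico 0 T := ⟨ht.1.le, ht.2.trans_lt ht₁.2⟩
      have hspos := hs t ⟨ht.1.le, ht.2⟩ x hx
      set B : Matrix (Fin d) (Fin d) ℝ := A t x - (A t x).transpose with hB
      set L := spaceGrad (u' (t, x)) with hL
      have hBs : ∀ i j, A t x i j - A t x j i = B i j := fun i j => by simp [hB]
      have hrate : ∀ i j, A' i j (t, x) (1, u t x) - A' j i (t, x) (1, u t x) =
          (L * B) i j + (B * L.transpose) i j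
            - (1 / We) * ((springFactor b (A t x))⁻¹ * B i j) := by
        intro i j
        rw [h.material_derivative hsol hDo htT hx hspos.ne' i j,
          h.material_derivative hsol hDo htT hx hspos.ne' j i]
        change (conformationRate We b L (A t x) - (conformationRate We b L (A t x)).transpose) i j
          = _
        have : conformationRate We b L (A t x) - (conformationRate We b L (A t x)).transpose =
            L * B + B * L.transpose - (1 / We) • ((springFactor b (A t x))⁻¹ • B) := by
          simp only [conformationRate, hB, Matrix.transpose_add, Matrix.transpose_sub,
            Matrix.transpose_mul, Matrix.transpose_smul, Matrix.transpose_one,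
            Matrix.transpose_transpose, mul_sub, sub_mul, smul_sub]
          abel
        rw [this]; simp
      have hN : ∑ i, ∑ j, B i j ^ 2 = δ * Real.exp (M * t) := by
        simp only [← hBs]; simp only at hzero; linarith
      have h1 := sum_mul_mul_le (B := B) (hC t ⟨ht.1.le, ht.2⟩ x hx)
      have h2 := sum_mul_mul_transpose_le (B := B) (hC t ⟨ht.1.le, ht.2⟩ x hx)
      have h3 : 0 ≤ (1 / We) * (springFactor b (A t x))⁻¹ := by positivity
      have hpos : 0 < δ * Real.exp (M * t) := by positivity
      have hsum : ∑ i, ∑ j, 2 * B i j * ((L * B) i j + (B * L.transpose) i j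
            - (1 / We) * ((springFactor b (A t x))⁻¹ * B i j)) =
          2 * (∑ i, ∑ j, B i j * (L * B) i j) + 2 * (∑ i, ∑ j, B i j * (B * L.transpose) i j)
            - 2 * ((1 / We) * (springFactor b (A t x))⁻¹) * ∑ i, ∑ j, B i j ^ 2 := by
        simp only [Finset.mul_sum, ← Finset.sum_add_distrib, ← Finset.sum_sub_distrib]
        refine Finset.sum_congr rfl fun i _ => Finset.sum_congr rfl fun j _ => ?_
        ring
      simp only [hBs, pow_one, sub_apply, sum_apply,
        smul_apply, smul_eq_mul, hrate, ContinuousLinearMap.coe_fst',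
        hsum, mul_one]
      rw [hN] at h1 h2 ⊢
      have h4 := mul_nonneg h3 hpos.le
      rw [hM] at *
      nlinarith
  intro t ht x hx i j
  have hle : ∑ i, ∑ j, (A t x i j - A t x j i) ^ 2 ≤ 0 := by
    refine le_of_forall_pos_lt_add fun η hη => ?_
    -- This `δ` makes the barrier equal to `η` at time `t`.
    have := key (η / Real.exp (M * t)) (by positivity) t ht x hx
    rw [div_mul_cancel₀ _ (Real.exp_pos _).ne'] at this
    linarith
  have h1 : (A t x i j - A t x j i) ^ 2 ≤ 0 :=
    calc _ ≤ ∑ j, (A t x i j - A t x j i) ^ 2 :=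
          Finset.single_le_sum (f := fun j => (A t x i j - A t x j i) ^ 2)
            (fun _ _ => sq_nonneg _) (Finset.mem_univ j)
      _ ≤ ∑ i, ∑ j, (A t x i j - A t x j i) ^ 2 :=
          Finset.single_le_sum (f := fun i => ∑ j, (A t x i j - A t x j i) ^ 2)
            (fun _ _ => by positivity) (Finset.mem_univ i)
      _ ≤ 0 := hle
  have := pow_eq_zero_iff (two_ne_zero) |>.1 (le_antisymm h1 (sq_nonneg _))
  linarith

end Positivity

/-! ### Persistence of positive definiteness. -/

section Definiteness

variable {d : ℕ} {Re We ε b T : ℝ} {D : Set (E d)} {u : ℝ → E d → E d} {p : ℝ → E d → ℝ}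
  {A : ℝ → E d → Matrix (Fin d) (Fin d) ℝ} {u' : ℝ × E d → ℝ × E d →L[ℝ] E d}
  {A' : Fin d → Fin d → ℝ × E d → ℝ × E d →L[ℝ] ℝ}

open Matrix in
theorem sum_sum_mul_eq_dotProduct_mulVec (M : Matrix (Fin d) (Fin d) ℝ) (v : Fin d → ℝ) :
    ∑ i, ∑ j, v i * v j * M i j = v ⬝ᵥ (M *ᵥ v) := by
  simp only [dotProduct, mulVec, Finset.mul_sum]
  exact Finset.sum_congr rfl fun i _ => Finset.sum_congr rfl fun j _ => by ring

open Matrix in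
theorem dotProduct_self_mul_le {M : Matrix (Fin d) (Fin d) ℝ} {c : ℝ}
    (hM : ∀ v : Fin d → ℝ, v ⬝ᵥ v = 1 → c ≤ v ⬝ᵥ (M *ᵥ v)) (v : Fin d → ℝ) :
    c * (v ⬝ᵥ v) ≤ v ⬝ᵥ (M *ᵥ v) := by
  by_cases hv : v = 0
  · simp [hv]
  have hpos : 0 < v ⬝ᵥ v := by
    simpa using dotProduct_star_self_pos_iff.2 hv
  have hsq : Real.sqrt (v ⬝ᵥ v) ^ 2 = v ⬝ᵥ v := Real.sq_sqrt hpos.le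
  have hspos : 0 < Real.sqrt (v ⬝ᵥ v) := Real.sqrt_pos.2 hpos
  set r := Real.sqrt (v ⬝ᵥ v)
  have h1 := hM (r⁻¹ • v) (by
    simp only [smul_dotProduct, dotProduct_smul, smul_eq_mul, ← hsq]; field_simp)
  simp only [mulVec_smul, smul_dotProduct, dotProduct_smul, smul_eq_mul] at h1
  rw [← hsq]
  calc c * r ^ 2 ≤ (r⁻¹ * (r⁻¹ * (v ⬝ᵥ (M *ᵥ v)))) * r ^ 2 := by gcongr
    _ = _ := by field_simp

theorem isCompact_unitVectors : IsCompact {v : Fin d → ℝ | dotProduct v v = 1} := by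
  refine (isCompact_Icc (a := fun _ : Fin d => (-1 : ℝ)) (b := fun _ => 1)).of_isClosed_subset
    (isClosed_eq (by unfold dotProduct; fun_prop) continuous_const) fun v hv => ?_
  have h1 : ∀ i, v i ^ 2 ≤ 1 := fun i => by
    rw [← show dotProduct v v = 1 from hv, sq]
    exact Finset.single_le_sum (f := fun i => v i * v i) (fun _ _ => mul_self_nonneg _)
      (Finset.mem_univ i)
  exact ⟨fun i => (abs_le.1 (sq_le_one_iff_abs_le_one _ |>.1 (h1 i))).1,
    fun i => (abs_le.1 (sq_le_one_iff_abs_le_one _ |>.1 (h1 i))).2⟩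

open Matrix in
/-- At a unit eigenvector of a symmetric `M`. -/
theorem dotProduct_conformationRate_mulVec {L M : Matrix (Fin d) (Fin d) ℝ} {v : Fin d → ℝ} {c : ℝ}
    (hM : M.transpose = M) (hv : v ⬝ᵥ v = 1) (hMv : M *ᵥ v = c • v) :
    v ⬝ᵥ (conformationRate We b L M *ᵥ v) =
      2 * c * (v ⬝ᵥ (L *ᵥ v)) - (1 / We) * ((springFactor b M)⁻¹ * c) + 1 / We := by
  have hvM : v ᵥ* M = c • v := by rw [← hM, vecMul_transpose, hMv]
  have h1 : v ⬝ᵥ ((L * M) *ᵥ v) = c * (v ⬝ᵥ (L *ᵥ v)) := by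
    rw [← mulVec_mulVec, hMv, mulVec_smul, dotProduct_smul, smul_eq_mul]
  have h2 : v ⬝ᵥ ((M * L.transpose) *ᵥ v) = c * (v ⬝ᵥ (L *ᵥ v)) := by
    rw [← mulVec_mulVec, dotProduct_mulVec, hvM, smul_dotProduct, smul_eq_mul, mulVec_transpose,
      dotProduct_comm v (v ᵥ* L), ← dotProduct_mulVec]
  simp only [conformationRate, add_mulVec, sub_mulVec, smul_mulVec, one_mulVec, dotProduct_add,
    dotProduct_sub, dotProduct_smul, smul_eq_mul, h1, h2, hMv, hv]
  ring

open Matrix in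
-- The maximum principle is applied to `c - vᵀ A v`, indexed by the compact set of unit vectors `v`.
-- At a first contact `c` is the lowest eigenvalue and `v` an eigenvector, so stretching and
-- relaxation are both `O(c)`, while the source contributes the fixed amount `1/We`.
theorem BoundaryDerivatives.posDef
    (h : BoundaryDerivatives T D u A u' A') (hsol : IsRegularSolution Re We ε b T D u p A)
    (hWe : 0 < We) (hDo : IsOpen D) (hDb : Bornology.IsBounded D)
    (hA₀ : ∀ x ∈ closure D, (A 0 x).PosDef) {t₁ s₀ : ℝ} (ht₁ : t₁ ∈ Ico 0 T) (hs₀ : 0 < s₀)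
    (hs : ∀ t ∈ Icc 0 t₁, ∀ x ∈ closure D, s₀ < springFactor b (A t x)) :
    ∀ t ∈ Icc 0 t₁, ∀ x ∈ closure D, (A t x).PosDef := by
  have hcA := hsol.conformation_continuousOn
  have h0T : (0 : ℝ) ∈ Ico 0 T := ⟨le_rfl, ht₁.1.trans_lt ht₁.2⟩
  have hsymm := h.isSymm hsol hWe hDo hDb (fun x hx i j => by
    simpa using ((hA₀ x hx).1.apply i j).symm) ht₁ fun t ht x hx => hs₀.trans (hs t ht x hx)
  set W : Set (Fin d → ℝ) := {v | v ⬝ᵥ v = 1} with hW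
  have hWc : IsCompact W := isCompact_unitVectors
  have hcq : ContinuousOn (fun q : (Fin d → ℝ) × (ℝ × E d) =>
      ∑ i, ∑ j, q.1 i * q.1 j * A q.2.1 q.2.2 i j) (W ×ˢ (Ico 0 T ×ˢ closure D)) := by
    refine continuousOn_finsetSum _ fun i _ => continuousOn_finsetSum _ fun j _ =>
      ContinuousOn.mul (by fun_prop) ?_
    exact (hsol.conformation_regular i j).continuousOn.comp continuousOn_snd fun q hq => hq.2
  obtain ⟨m, hm, hmb⟩ : ∃ m > 0, ∀ v ∈ W, ∀ x ∈ closure D,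
      m < ∑ i, ∑ j, v i * v j * A 0 x i j := by
    have hK := hWc.prod hDb.isCompact_closure
    rcases (W ×ˢ closure D).eq_empty_or_nonempty with he | hne
    · refine ⟨1, one_pos, fun v hv x hx => ?_⟩
      have : (v, x) ∈ W ×ˢ closure D := ⟨hv, hx⟩
      rw [he] at this
      exact this.elim
    · have hc : ContinuousOn (fun q : (Fin d → ℝ) × E d => ∑ i, ∑ j, q.1 i * q.1 j * A 0 q.2 i j)
          (W ×ˢ closure D) :=
        hcq.comp (f := fun q : (Fin d → ℝ) × E d => (q.1, ((0 : ℝ), q.2))) (by fun_prop)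
          fun q hq => ⟨hq.1, h0T, hq.2⟩
      obtain ⟨⟨v, x⟩, ⟨hv, hx⟩, hmin⟩ := hK.exists_isMinOn hne hc
      have hpos : 0 < ∑ i, ∑ j, v i * v j * A 0 x i j := by
        rw [sum_sum_mul_eq_dotProduct_mulVec]
        have hv0 : v ≠ 0 := by
          rintro rfl
          simp [hW] at hv
        simpa using (hA₀ x hx).dotProduct_mulVec_pos hv0
      exact ⟨_, half_pos hpos, fun w hw y hy =>
        (half_lt_self hpos).trans_le (hmin (show (w, y) ∈ W ×ˢ closure D from ⟨hw, hy⟩))⟩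
  obtain ⟨C, hC0, hC⟩ := h.exists_spaceGrad_bound hDb ht₁.2
  have hquad : ∀ t ∈ Icc 0 t₁, ∀ x ∈ closure D, ∀ v ∈ W,
      |v ⬝ᵥ (spaceGrad (u' (t, x)) *ᵥ v)| ≤ C * d ^ 2 := by
    intro t ht x hx v hv
    have hv1 : ∀ i, |v i| ≤ 1 := fun i => by
      rw [← sq_le_one_iff_abs_le_one, ← show dotProduct v v = 1 from hv, sq]
      exact Finset.single_le_sum (f := fun i => v i * v i) (fun _ _ => mul_self_nonneg _)
        (Finset.mem_univ i)
    rw [← sum_sum_mul_eq_dotProduct_mulVec]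
    calc _ ≤ ∑ i, ∑ j, |v i * v j * spaceGrad (u' (t, x)) i j| :=
          (Finset.abs_sum_le_sum_abs _ _).trans
            (Finset.sum_le_sum fun i _ => Finset.abs_sum_le_sum_abs _ _)
      _ ≤ ∑ _i : Fin d, ∑ _j : Fin d, C := by
          refine Finset.sum_le_sum fun i _ => Finset.sum_le_sum fun j _ => ?_
          rw [abs_mul, abs_mul]
          calc _ ≤ 1 * 1 * C := mul_le_mul (mul_le_mul (hv1 i) (hv1 j) (abs_nonneg _) zero_le_one)
                (hC t ht x hx i j) (abs_nonneg _) (by norm_num)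
            _ = C := by ring
      _ = C * d ^ 2 := by simp; ring
  -- `c Q` bounds the stretching and relaxation losses, with `c` to spare. Taking `c Q ≤ 1/(2 We)`
  -- keeps them below the source, and `c ≤ m` fits the initial data.
  set Q : ℝ := 2 * (C * d ^ 2) + 1 / We * s₀⁻¹ + 1 with hQ
  have hQpos : 0 < Q := by positivity
  set c : ℝ := min m (1 / We / (2 * Q)) with hc
  have hcpos : 0 < c := lt_min hm (by positivity)
  have hcm : c ≤ m := min_le_left _ _
  have hcQ : c * (2 * Q) ≤ 1 / We := (le_div_iff₀ (by positivity)).1 (min_le_right _ _)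
  have hmax := transport_max_principle hWc hDo hDb
    hsol.no_slip (φ := fun v z => c - ∑ i, ∑ j, v i * v j * A z.1 z.2 i j)
    (φ' := fun v z => -∑ i, ∑ j, (v i * v j) • A' i j z) ?_ ?_ ?_ ht₁.2 ?_
  · intro t ht x hx
    have h1 : ∀ v : Fin d → ℝ, v ⬝ᵥ v = 1 → c ≤ v ⬝ᵥ (A t x *ᵥ v) := fun v hv => by
      have := hmax t ht v hv x hx
      rw [← sum_sum_mul_eq_dotProduct_mulVec]
      simp only at this; linarith
    refine PosDef.of_dotProduct_mulVec_pos (IsHermitian.ext fun i j => ?_) fun v hv => ?_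
    · simpa using (hsymm t ht x hx i j).symm
    · have hpos : 0 < v ⬝ᵥ v := by simpa using dotProduct_star_self_pos_iff.2 hv
      have := (mul_pos hcpos hpos).trans_le (dotProduct_self_mul_le h1 v)
      simpa using this
  · exact continuousOn_const.sub hcq
  · intro v _ z hz
    have h1 : HasFDerivWithinAt (fun z : ℝ × E d => ∑ i, ∑ j, v i * v j * A z.1 z.2 i j)
        (∑ i, ∑ j, (v i * v j) • A' i j z) (Ico 0 T ×ˢ closure D) z :=
      HasFDerivWithinAt.fun_sum fun i _ => HasFDerivWithinAt.fun_sum fun j _ =>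
        (h.conformation_hasFDerivWithinAt i j z hz).const_mul _
    exact h1.const_sub c
  · intro v hv x hx
    have := hmb v hv x hx
    simp only; linarith
  · intro t ht v hv x hx hzero hle
    have htT : t ∈ Ico 0 T := ⟨ht.1.le, ht.2.trans_lt ht₁.2⟩
    have ht' : t ∈ Icc 0 t₁ := ⟨ht.1.le, ht.2⟩
    have hsf := hs t ht' x hx
    have hspos := hs₀.trans hsf
    have hrate : (-∑ i, ∑ j, (v i * v j) • A' i j (t, x)) (1, u t x) =
        -(v ⬝ᵥ (conformationRate We b (spaceGrad (u' (t, x))) (A t x) *ᵥ v)) := by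
      rw [← sum_sum_mul_eq_dotProduct_mulVec]
      simp only [_root_.neg_apply, _root_.sum_apply, _root_.smul_apply, smul_eq_mul,
        h.material_derivative hsol hDo htT hx hspos.ne']
    have hT : (A t x).transpose = A t x := by
      ext i j; exact hsymm t ht' x hx j i
    have hlow : ∀ w : Fin d → ℝ, c * (w ⬝ᵥ w) ≤ w ⬝ᵥ (A t x *ᵥ w) :=
      dotProduct_self_mul_le fun w hw => by
        have := hle w hw x hx
        rw [← sum_sum_mul_eq_dotProduct_mulVec]
        simp only at this; linarith
    have hv1 : v ⬝ᵥ v = 1 := hv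
    have hexp : ∀ w : Fin d → ℝ, w ⬝ᵥ ((A t x - c • (1 : Matrix (Fin d) (Fin d) ℝ)) *ᵥ w) =
        w ⬝ᵥ (A t x *ᵥ w) - c * (w ⬝ᵥ w) := fun w => by
      simp [sub_mulVec, smul_mulVec, dotProduct_sub]
    have hpsd : (A t x - c • (1 : Matrix (Fin d) (Fin d) ℝ)).PosSemidef := by
      refine PosSemidef.of_dotProduct_mulVec_nonneg ?_ fun w => ?_
      · rw [IsHermitian, conjTranspose_eq_transpose_of_trivial]
        simp [hT]
      · rw [star_trivial, hexp]; linarith [hlow w]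
    -- The form of `A - c I` is nonnegative because no other unit vector has crossed the barrier. A
    -- positive semidefinite matrix annihilates every vector on which its form vanishes, here `v`.
    have hev : A t x *ᵥ v = c • v := by
      have h1 := (hpsd.dotProduct_mulVec_zero_iff v).1 (by
        rw [star_trivial, hexp, hv1, ← sum_sum_mul_eq_dotProduct_mulVec]
        simp only at hzero; linarith)
      rw [sub_mulVec, smul_mulVec, one_mulVec] at h1
      exact sub_eq_zero.1 h1
    rw [hrate, dotProduct_conformationRate_mulVec hT hv1 hev]
    have h3 := (abs_le.1 (hquad t ht' x hx v hv)).1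
    have h4 : (springFactor b (A t x))⁻¹ ≤ s₀⁻¹ := inv_anti₀ hs₀ hsf.le
    have h5 : (1 / We) * ((springFactor b (A t x))⁻¹ * c) ≤ 1 / We * s₀⁻¹ * c := by
      rw [mul_assoc]; gcongr
    have h6 : -(2 * (C * d ^ 2)) * c ≤ 2 * c * (v ⬝ᵥ (spaceGrad (u' (t, x)) *ᵥ v)) := by
      nlinarith
    have h7 : c * (2 * Q) = 2 * (c * Q) := by ring
    have h8 : c * Q = 2 * (C * d ^ 2) * c + 1 / We * s₀⁻¹ * c + c := by rw [hQ]; ring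
    have h9 : 0 < 1 / We := by positivity
    linarith [mul_pos hcpos hQpos]

theorem IsRegularSolution.posDef_and_trace_lt
    (hsol : IsRegularSolution Re We ε b T D u p A)
    (hWe : 0 < We) (hb : 0 < b) (hDo : IsOpen D) (hDb : Bornology.IsBounded D)
    (hA₀ : ∀ x ∈ closure D, (A 0 x).PosDef) (htr₀ : ∀ x ∈ closure D, (A 0 x).trace < b)
    {t : ℝ} (ht : t ∈ Ico 0 T) {x : E d} (hx : x ∈ closure D) :
    (A t x).PosDef ∧ (A t x).trace < b := by
  obtain ⟨u', A', h⟩ := hsol.exists_boundaryDerivatives hDo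
  obtain ⟨s₀, hs₀, hs⟩ := h.springFactor_lower_bound hsol hWe hb hDo hDb htr₀ ht
  refine ⟨h.posDef hsol hWe hDo hDb hA₀ ht hs₀ hs t ⟨ht.1, le_rfl⟩ x hx, ?_⟩
  have := hs₀.trans (hs t ⟨ht.1, le_rfl⟩ x hx)
  unfold springFactor at this
  exact (div_lt_one hb).1 (by linarith)

end Definiteness

/-! ### Calculus of the determinant and of the entropy density. -/

section MatrixCalculus

variable {X : Type*} [NormedAddCommGroup X] [NormedSpace ℝ X] {d : ℕ} {b : ℝ}

theorem contDiffOn_det {M : X → Matrix (Fin d) (Fin d) ℝ} {S : Set X} {n : WithTop ℕ∞}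
    (hM : ∀ i j, ContDiffOn ℝ n (fun z => M z i j) S) : ContDiffOn ℝ n (fun z => (M z).det) S := by
  simp only [Matrix.det_apply]
  exact ContDiffOn.sum fun σ _ => (contDiffOn_prod fun i _ => hM (σ i) i).const_smul _

theorem contDiffOn_springFactor {M : X → Matrix (Fin d) (Fin d) ℝ} {S : Set X} {n : WithTop ℕ∞}
    (hM : ∀ i j, ContDiffOn ℝ n (fun z => M z i j) S) :
    ContDiffOn ℝ n (fun z => springFactor b (M z)) S := by
  simp only [springFactor, Matrix.trace, Matrix.diag_apply]
  exact contDiffOn_const.sub ((ContDiffOn.sum fun i _ => hM i i).div_const b)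

theorem contDiffOn_entropyDensity {M : X → Matrix (Fin d) (Fin d) ℝ} {S : Set X} {n : WithTop ℕ∞}
    (hM : ∀ i j, ContDiffOn ℝ n (fun z => M z i j) S) (hdet : ∀ z ∈ S, (M z).det ≠ 0)
    (hs : ∀ z ∈ S, springFactor b (M z) ≠ 0) :
    ContDiffOn ℝ n (fun z => entropyDensity b (M z)) S :=
  ((contDiffOn_det hM).log hdet).neg.sub
    (contDiffOn_const.mul ((contDiffOn_springFactor hM).log hs))

/-- Jacobi's formula: after factoring out `M`, `det (1 + r N) = 1 + r tr N + O(r²)`, the remainder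
being a polynomial multiple of `r²`. -/
theorem hasDerivAt_det_add_smul {M : Matrix (Fin d) (Fin d) ℝ} (hM : M.det ≠ 0)
    (B : Matrix (Fin d) (Fin d) ℝ) :
    HasDerivAt (fun r : ℝ => (M + r • B).det) (M.det * (M⁻¹ * B).trace) 0 := by
  have h1 : ∀ r : ℝ, (M + r • B).det = M.det * (1 + r • (M⁻¹ * B)).det := fun r => by
    rw [← Matrix.det_mul, mul_add, mul_one, Matrix.mul_smul, ← mul_assoc,
      Matrix.mul_nonsing_inv _ (isUnit_iff_ne_zero.2 hM), one_mul]
  rw [funext fun r => (h1 r).trans (congrArg _ (Matrix.det_one_add_smul r _))]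
  refine HasDerivAt.const_mul _ ?_
  set q := (Matrix.det (1 + (Polynomial.X : Polynomial ℝ) • (M⁻¹ * B).map Polynomial.C)).divX.divX
  have h2 : HasDerivAt (fun r : ℝ => 1 + (M⁻¹ * B).trace * r + q.eval r * r ^ 2)
      (0 + (M⁻¹ * B).trace * 1 + (q.derivative.eval 0 * 0 ^ 2 + q.eval 0 * (2 * 0 ^ (2 - 1) * 1)))
      0 := by
    refine ((hasDerivAt_const _ _).add ((hasDerivAt_id _).const_mul _)).add
      ((q.hasDerivAt 0).mul ?_)
    simpa using hasDerivAt_pow 2 (0 : ℝ)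
  simpa using h2

theorem hasFDerivWithinAt_det {M : X → Matrix (Fin d) (Fin d) ℝ} {M' : Fin d → Fin d → X →L[ℝ] ℝ}
    {S : Set X} {z : X} (hM : ∀ i j, HasFDerivWithinAt (fun z => M z i j) (M' i j) S z)
    (hdet : (M z).det ≠ 0) :
    HasFDerivWithinAt (fun z => (M z).det)
      ((M z).det • ∑ i, ∑ j, (M z)⁻¹ i j • M' j i) S z := by
  set f : (Fin d → Fin d → ℝ) → ℝ := fun N => (Matrix.of N).det
  have hf : DifferentiableAt ℝ f (M z) := by
    have : ContDiffOn ℝ 1 f univ := contDiffOn_det (M := fun N => Matrix.of N) fun i j => by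
      simp only [Matrix.of_apply]; fun_prop
    exact (contDiffOn_univ.1 this).differentiable one_ne_zero _
  let N : Fin d → Fin d → ℝ := M z
  -- Differentiability is already known, the determinant being polynomial in the entries; the value
  -- of the derivative is read off along lines.
  have hval : ∀ B : Fin d → Fin d → ℝ,
      fderiv ℝ f N B = (M z).det * ((M z)⁻¹ * Matrix.of B).trace := by
    intro B
    have h1 : HasDerivAt (fun r : ℝ => N + r • B) B 0 := by
      simpa using ((hasDerivAt_id (0 : ℝ)).smul_const B).const_add N
    have h2 : HasDerivAt (fun r : ℝ => f (N + r • B))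
        (fderiv ℝ f N B) 0 :=
      HasFDerivAt.comp_hasDerivAt (x := (0 : ℝ)) (l := f)
        (f := fun r : ℝ => N + r • B)
        (by simpa using hf.hasFDerivAt) h1
    exact h2.unique (hasDerivAt_det_add_smul hdet (Matrix.of B))
  have h3 : HasFDerivWithinAt (fun y => (M y : Fin d → Fin d → ℝ))
      (ContinuousLinearMap.pi fun i => ContinuousLinearMap.pi fun j => M' i j) S z :=
    hasFDerivWithinAt_pi.2 fun i => hasFDerivWithinAt_pi.2 fun j => hM i j
  refine (hf.hasFDerivAt.comp_hasFDerivWithinAt z h3).congr_fderiv ?_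
  ext w
  simp only [ContinuousLinearMap.comp_apply, smul_apply, sum_apply, smul_eq_mul]
  refine (hval _).trans ?_
  simp only [Matrix.trace, Matrix.diag_apply, Matrix.mul_apply, Matrix.of_apply,
    ContinuousLinearMap.coe_pi']

/-- The derivative of the entropy density along entrywise derivatives `M'` of `M`. -/
def entropyDeriv (b : ℝ) (M : Matrix (Fin d) (Fin d) ℝ) (M' : Fin d → Fin d → X →L[ℝ] ℝ) :
    X →L[ℝ] ℝ :=
  -(∑ i, ∑ j, M⁻¹ i j • M' j i) + (springFactor b M)⁻¹ • ∑ i, M' i i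

theorem hasFDerivWithinAt_entropyDensity (hb : b ≠ 0) {M : X → Matrix (Fin d) (Fin d) ℝ}
    {M' : Fin d → Fin d → X →L[ℝ] ℝ}
    {S : Set X} {z : X} (hM : ∀ i j, HasFDerivWithinAt (fun z => M z i j) (M' i j) S z)
    (hdet : (M z).det ≠ 0) (hs : springFactor b (M z) ≠ 0) :
    HasFDerivWithinAt (fun z => entropyDensity b (M z)) (entropyDeriv b (M z) M') S z := by
  have h1 := (hasFDerivWithinAt_det hM hdet).log hdet
  have h2 : HasFDerivWithinAt (fun z => springFactor b (M z)) (-(b⁻¹ • ∑ i, M' i i)) S z := by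
    simp only [springFactor, Matrix.trace, Matrix.diag_apply, div_eq_inv_mul]
    exact ((HasFDerivWithinAt.fun_sum fun i _ => hM i i).const_mul b⁻¹).const_sub 1
  refine (h1.neg.sub ((h2.log hs).const_mul b)).congr_fderiv ?_
  ext w
  simp only [entropyDeriv, smul_apply, sub_apply, neg_apply, add_apply, smul_eq_mul]
  field_simp
  ring

theorem entropyDeriv_apply (M : Matrix (Fin d) (Fin d) ℝ) (M' : Fin d → Fin d → X →L[ℝ] ℝ) (w : X)
    {R : Matrix (Fin d) (Fin d) ℝ} (hR : ∀ i j, M' i j w = R i j) :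
    entropyDeriv b M M' w = -(M⁻¹ * R).trace + (springFactor b M)⁻¹ * R.trace := by
  simp only [entropyDeriv, add_apply, neg_apply, sum_apply, smul_apply, smul_eq_mul, hR,
    Matrix.trace, Matrix.diag_apply, Matrix.mul_apply]

/-- Against `M⁻¹` both stretching terms reduce to `tr L`; against the identity both become `L : M`.
The relaxation and source terms assemble into `dissipationDensity`. The term `tr L` is kept, since
it matches the `-I` in the stress. -/
theorem entropy_production {We : ℝ} {L M : Matrix (Fin d) (Fin d) ℝ} (hM : M.transpose = M)
    (hdet : M.det ≠ 0) :
    -(M⁻¹ * conformationRate We b L M).trace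
        + (springFactor b M)⁻¹ * (conformationRate We b L M).trace =
      2 * ((springFactor b M)⁻¹ * (∑ i, ∑ j, L i j * M i j) - L.trace)
        - 1 / We * dissipationDensity b M := by
  have hu : IsUnit M.det := isUnit_iff_ne_zero.2 hdet
  have hLM : (L * M).trace = ∑ i, ∑ j, L i j * M i j := by
    simp only [Matrix.trace, Matrix.diag_apply, Matrix.mul_apply]
    refine Finset.sum_congr rfl fun i _ => Finset.sum_congr rfl fun j _ => ?_
    conv_lhs => rw [← hM, Matrix.transpose_apply]
  have hML : (M * L.transpose).trace = ∑ i, ∑ j, L i j * M i j := by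
    rw [← hLM, ← Matrix.trace_transpose, Matrix.transpose_mul, Matrix.transpose_transpose, hM]
  have h1 : (M⁻¹ * (L * M)).trace = L.trace := by
    rw [← mul_assoc, Matrix.trace_mul_comm, ← mul_assoc, Matrix.mul_nonsing_inv _ hu, one_mul]
  have h2 : (M⁻¹ * (M * L.transpose)).trace = L.trace := by
    rw [← mul_assoc, Matrix.nonsing_inv_mul _ hu, one_mul, Matrix.trace_transpose]
  rw [trace_conformationRate, Matrix.trace_add, hLM, hML]
  simp only [conformationRate, mul_add, mul_sub, Matrix.trace_add, Matrix.trace_sub, h1, h2,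
    Matrix.mul_smul, Matrix.trace_smul, Matrix.nonsing_inv_mul _ hu, Matrix.trace_one, mul_one,
    smul_eq_mul, Fintype.card_fin, dissipationDensity, div_eq_mul_inv, one_mul]
  ring

theorem continuousOn_inv_entry {Z : Type*} [TopologicalSpace Z] {M : Z → Matrix (Fin d) (Fin d) ℝ}
    {S : Set Z} (hM : ContinuousOn M S) (hdet : ∀ z ∈ S, (M z).det ≠ 0) (i j : Fin d) :
    ContinuousOn (fun z => (M z)⁻¹ i j) S := by
  have h1 : ContinuousOn (fun z => (M z).det) S :=
    (Continuous.matrix_det continuous_id).comp_continuousOn hM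
  have h2 : ContinuousOn (fun z => (M z).adjugate) S :=
    (Continuous.matrix_adjugate continuous_id).comp_continuousOn hM
  simp only [Matrix.inv_def, Ring.inverse_eq_inv', Matrix.smul_apply, smul_eq_mul]
  exact (h1.inv₀ hdet).mul (continuousOn_pi.1 (continuousOn_pi.1 h2 i) j)

theorem continuousOn_dissipationDensity {Z : Type*} [TopologicalSpace Z]
    {M : Z → Matrix (Fin d) (Fin d) ℝ} {S : Set Z} (hM : ContinuousOn M S)
    (hdet : ∀ z ∈ S, (M z).det ≠ 0) (hs : ∀ z ∈ S, springFactor b (M z) ≠ 0) :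
    ContinuousOn (fun z => dissipationDensity b (M z)) S := by
  have h1 : ContinuousOn (fun z => springFactor b (M z)) S :=
    continuous_springFactor.comp_continuousOn hM
  have h2 : ContinuousOn (fun z => (M z).trace) S :=
    (Continuous.matrix_trace continuous_id).comp_continuousOn hM
  have h3 : ContinuousOn (fun z => (M z)⁻¹.trace) S :=
    continuousOn_finsetSum _ fun i _ => continuousOn_inv_entry hM hdet i i
  exact ((h2.div (h1.pow 2) fun z hz => pow_ne_zero 2 (hs z hz)).sub
    (continuousOn_const.div h1 hs)).add h3

theorem continuousOn_entropyDeriv {Z : Type*} [TopologicalSpace Z]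
    {M : Z → Matrix (Fin d) (Fin d) ℝ} {M' : Fin d → Fin d → Z → X →L[ℝ] ℝ} {S : Set Z}
    (hM : ContinuousOn M S) (hM' : ∀ i j, ContinuousOn (M' i j) S)
    (hdet : ∀ z ∈ S, (M z).det ≠ 0) (hs : ∀ z ∈ S, springFactor b (M z) ≠ 0) :
    ContinuousOn (fun z => entropyDeriv b (M z) (fun i j => M' i j z)) S := by
  have h1 : ContinuousOn (fun z => springFactor b (M z)) S :=
    continuous_springFactor.comp_continuousOn hM
  refine ContinuousOn.add (ContinuousOn.neg ?_) ((h1.inv₀ hs).smul ?_)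
  · exact continuousOn_finsetSum _ fun i _ => continuousOn_finsetSum _ fun j _ =>
      (continuousOn_inv_entry hM hdet i j).smul (hM' j i)
  · exact continuousOn_finsetSum _ fun i _ => hM' i i

end MatrixCalculus

/-! ### Integration by parts for transport, stress and viscosity. -/

section IntegrationByParts

variable {d : ℕ} {D : Set (E d)}

theorem sum_smul_single (v : E d) : ∑ j, v j • EuclideanSpace.single j (1 : ℝ) = v := by
  ext i
  simp [Finset.sum_apply, Pi.single_apply]

theorem fderiv_apply_eq_sum (g : E d → ℝ) (x v : E d) :
    fderiv ℝ g x v = ∑ j, v j * partialDeriv j g x := by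
  conv_lhs => rw [← sum_smul_single v]
  simp [partialDeriv]

theorem contDiffOn_coord {v : E d → E d} {S : Set (E d)} {n : WithTop ℕ∞}
    (hv : ContDiffOn ℝ n v S) (i : Fin d) : ContDiffOn ℝ n (fun y => v y i) S :=
  (EuclideanSpace.proj (𝕜 := ℝ) i).contDiff.comp_contDiffOn hv

theorem integrableOn_mul_partialDeriv (hDo : IsOpen D) (hDb : Bornology.IsBounded D)
    {f g : E d → ℝ} (hf : ContinuousOn f (closure D)) (hg : ContDiffOn ℝ 1 g (closure D))
    (j : Fin d) : IntegrableOn (fun x => f x * partialDeriv j g x) D := by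
  obtain ⟨g', hg', hgg'⟩ := exists_continuousOn_partialDeriv hDo hg j
  exact integrableOn_of_eqOn_continuousOn_closure hDo hDb (hf.mul hg')
    fun x hx => by rw [hgg' x hx]; rfl

theorem integrableOn_partialDeriv_mul (hDo : IsOpen D) (hDb : Bornology.IsBounded D)
    {f g : E d → ℝ} (hf : ContinuousOn f (closure D)) (hg : ContDiffOn ℝ 1 g (closure D))
    (j : Fin d) : IntegrableOn (fun x => partialDeriv j g x * f x) D := by
  simpa only [mul_comm] using integrableOn_mul_partialDeriv hDo hDb hf hg j

/-- Transport by a divergence-free field vanishing at the boundary has mean zero. -/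
theorem setIntegral_fderiv_apply_eq_zero (hDo : IsOpen D) (hDb : Bornology.IsBounded D)
    {v : E d → E d} {g : E d → ℝ} (hv : ContDiffOn ℝ 1 v (closure D))
    (h0 : ∀ x ∈ frontier D, v x = 0) (hdiv : ∀ x ∈ D, divVec v x = 0)
    (hg : ContDiffOn ℝ 1 g (closure D)) :
    IntegrableOn (fun x => fderiv ℝ g x (v x)) D ∧ ∫ x in D, fderiv ℝ g x (v x) = 0 := by
  have hv' := fun j => contDiffOn_coord hv j
  have hint := fun j => integrableOn_mul_partialDeriv hDo hDb (hv' j).continuousOn hg j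
  have hint' := fun j => integrableOn_partialDeriv_mul hDo hDb hg.continuousOn (hv' j) j
  simp only [fderiv_apply_eq_sum]
  refine ⟨integrable_finsetSum _ fun j _ => hint j, ?_⟩
  rw [integral_finsetSum _ fun j _ => hint j]
  have h1 : ∀ j, ∫ x in D, v x j * partialDeriv j g x =
      -∫ x in D, partialDeriv j (fun y => v y j) x * g x := fun j =>
    setIntegral_mul_partialDeriv hDo hDb (hv' j) hg (fun x hx => by simp [h0 x hx]) j
  simp only [h1, Finset.sum_neg_distrib]
  rw [← integral_finsetSum _ fun j _ => hint' j, neg_eq_zero]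
  refine setIntegral_eq_zero_of_forall_eq_zero fun x hx => ?_
  rw [← Finset.sum_mul]
  simp [show ∑ j, partialDeriv j (fun y => v y j) x = 0 from hdiv x hx]

open scoped InnerProductSpace in
theorem setIntegral_inner_divMat (hDo : IsOpen D) (hDb : Bornology.IsBounded D)
    {v : E d → E d} {σ : E d → Matrix (Fin d) (Fin d) ℝ} (hv : ContDiffOn ℝ 1 v (closure D))
    (h0 : ∀ x ∈ frontier D, v x = 0)
    (hσ : ∀ i j, ContDiffOn ℝ 1 (fun y => σ y i j) (closure D)) :
    IntegrableOn (fun x => ⟪v x, divMat σ x⟫_ℝ) D ∧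
    IntegrableOn (fun x => ∑ i, ∑ j, gradMat v x i j * σ x i j) D ∧
      ∫ x in D, ⟪v x, divMat σ x⟫_ℝ = -∫ x in D, ∑ i, ∑ j, gradMat v x i j * σ x i j := by
  have hv' := fun j => contDiffOn_coord hv j
  have hint := fun i j =>
    integrableOn_mul_partialDeriv hDo hDb (hv' i).continuousOn (hσ i j) j
  have hint' := fun i j =>
    integrableOn_partialDeriv_mul hDo hDb (hσ i j).continuousOn (hv' i) j
  have hinner : ∀ x, ⟪v x, divMat σ x⟫_ℝ =
      ∑ i, ∑ j, v x i * partialDeriv j (fun y => σ y i j) x := fun x => by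
    rw [PiLp.inner_apply]
    simp only [← Finset.mul_sum]
    simp [divMat, mul_comm]
  have hs : IntegrableOn (fun x => ∑ i, ∑ j, gradMat v x i j * σ x i j) D :=
    integrable_finsetSum _ fun i _ => integrable_finsetSum _ fun j _ => hint' i j
  simp only [hinner]
  refine ⟨integrable_finsetSum _ fun i _ => integrable_finsetSum _ fun j _ => hint i j, hs, ?_⟩
  change _ = -∫ x in D, ∑ i, ∑ j, partialDeriv j (fun y => v y i) x * σ x i j
  rw [integral_finsetSum _ fun i _ => integrable_finsetSum _ fun j _ => hint i j,
    integral_finsetSum _ fun i _ => integrable_finsetSum _ fun j _ => hint' i j,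
    ← Finset.sum_neg_distrib]
  refine Finset.sum_congr rfl fun i _ => ?_
  rw [integral_finsetSum _ fun j _ => hint i j, integral_finsetSum _ fun j _ => hint' i j,
    ← Finset.sum_neg_distrib]
  exact Finset.sum_congr rfl fun j _ =>
    setIntegral_mul_partialDeriv hDo hDb (hv' i) (hσ i j) (fun x hx => by simp [h0 x hx]) j

open scoped InnerProductSpace in
-- `Δv = div ∇v` reduces this to the previous identity. That identity needs a field that is `C¹` up
-- to the boundary, so `∇v` is replaced by `σ`, built from the extension `v'` of the derivative and
-- equal to it on `D`.
theorem setIntegral_inner_laplacian (hDo : IsOpen D) (hDb : Bornology.IsBounded D)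
    {v : E d → E d} (hv : ContDiffOn ℝ 2 v (closure D)) (h0 : ∀ x ∈ frontier D, v x = 0) :
    IntegrableOn (fun x => ⟪v x, Laplacian.laplacian v x⟫_ℝ) D ∧
      ∫ x in D, ⟪v x, Laplacian.laplacian v x⟫_ℝ = -∫ x in D, sqNorm (gradMat v x) := by
  obtain ⟨v', hc, hd⟩ := exists_contDiffOn_hasFDerivWithinAt (n := 1)
    (by simpa [one_add_one_eq_two] using hv) subset_closure subset_rfl hDo.uniqueDiffOn
  rw [Nat.cast_one] at hc
  have hnear : ∀ x ∈ D, fderiv ℝ v =ᶠ[𝓝 x] v' := fun x hx => by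
    filter_upwards [hDo.mem_nhds hx] with y hy
    exact ((hd y (subset_closure hy)).hasFDerivAt
      (mem_of_superset (hDo.mem_nhds hy) subset_closure)).fderiv
  have hcd : ∀ x ∈ D, DifferentiableAt ℝ v' x := fun x hx =>
    (hc.differentiableOn one_ne_zero).differentiableAt
      (mem_of_superset (hDo.mem_nhds hx) subset_closure)
  set σ : E d → Matrix (Fin d) (Fin d) ℝ :=
    fun x => Matrix.of fun i j => v' x (EuclideanSpace.single j 1) i with hσdef
  have hσ : ∀ i j, ContDiffOn ℝ 1 (fun y => σ y i j) (closure D) := fun i j =>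
    contDiffOn_coord (hc.clm_apply contDiffOn_const) i
  have hgrad : ∀ x ∈ D, gradMat v x = σ x := by
    intro x hx
    ext i j
    have h2 := (EuclideanSpace.proj (𝕜 := ℝ) i).hasFDerivAt.comp_hasFDerivWithinAt x
      (hd x (subset_closure hx))
    exact partialDeriv_eq_of_hasFDerivWithinAt hDo hx h2 j
  have hlap : ∀ x ∈ D, Laplacian.laplacian v x = divMat σ x := by
    intro x hx
    rw [InnerProductSpace.laplacian_eq_iteratedFDeriv_orthonormalBasis v
      (EuclideanSpace.basisFun (Fin d) ℝ)]
    ext i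
    simp only [divMat, WithLp.ofLp_sum, Finset.sum_apply]
    refine Finset.sum_congr rfl fun j _ => ?_
    rw [iteratedFDeriv_two_apply, (hnear x hx).fderiv_eq]
    have h1 := ((hcd x hx).hasFDerivAt.clm_apply
      (hasFDerivAt_const (EuclideanSpace.single j (1 : ℝ)) x))
    have h2 := (EuclideanSpace.proj (𝕜 := ℝ) i).hasFDerivAt.comp x h1
    have h3 : partialDeriv j (fun y => σ y i j) x = _ :=
      congrArg (fun L : E d →L[ℝ] ℝ => L (EuclideanSpace.single j 1)) h2.fderiv
    rw [h3]
    simp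
  obtain ⟨h1, -, h2⟩ := setIntegral_inner_divMat hDo hDb (hv.of_le one_le_two) h0 hσ
  refine ⟨h1.congr_fun (fun x hx => by simp only [hlap x hx]) hDo.measurableSet, ?_⟩
  rw [setIntegral_congr_fun hDo.measurableSet (g := fun x => ⟪v x, divMat σ x⟫_ℝ)
    (fun x hx => by simp only [hlap x hx]), h2]
  congr 1
  refine setIntegral_congr_fun hDo.measurableSet fun x hx => ?_
  simp only [sqNorm, hgrad x hx, sq]

end IntegrationByParts

/-! ### Kinetic and entropy balances. -/

section Energy

variable {d : ℕ} {Re We ε b T : ℝ} {D : Set (E d)} {u : ℝ → E d → E d} {p : ℝ → E d → ℝ}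
  {A : ℝ → E d → Matrix (Fin d) (Fin d) ℝ} {u' : ℝ × E d → ℝ × E d →L[ℝ] E d}
  {A' : Fin d → Fin d → ℝ × E d → ℝ × E d →L[ℝ] ℝ}

open scoped InnerProductSpace

theorem inner_gradient_right_eq (g : E d → ℝ) (x v : E d) :
    ⟪v, gradient g x⟫_ℝ = fderiv ℝ g x v := by
  rw [real_inner_comm, gradient, InnerProductSpace.toDual_symm_apply]

theorem continuous_sqNorm : Continuous (sqNorm : Matrix (Fin d) (Fin d) ℝ → ℝ) := by
  unfold sqNorm; fun_prop

/-- The kinetic energy balance. -/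
theorem BoundaryDerivatives.kinetic_balance
    (h : BoundaryDerivatives T D u A u' A') (hsol : IsRegularSolution Re We ε b T D u p A)
    (hDo : IsOpen D) (hDb : Bornology.IsBounded D) {t : ℝ} (ht : t ∈ Ioo 0 T)
    (hs : ∀ x ∈ closure D, springFactor b (A t x) ≠ 0) :
    IntegrableOn (fun x => ∑ i, ∑ j, gradMat (u t) x i j * stress We ε b (A t x) i j) D ∧
    Re * ∫ x in D, ⟪u t x, u' (t, x) (1, 0)⟫_ℝ =
      -((1 - ε) * ∫ x in D, sqNorm (gradMat (u t) x))
        - ∫ x in D, ∑ i, ∑ j, gradMat (u t) x i j * stress We ε b (A t x) i j := by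
  have ht' : t ∈ Ico 0 T := ⟨ht.1.le, ht.2⟩
  have hu1 : ContDiffOn ℝ 1 (u t) (closure D) := contDiffOn_slice hsol.velocity_regular ht'
  have hnsp := hsol.no_slip t ht'
  have hdiv := hsol.incompressible t ht
  have hstress : ∀ i j, ContDiffOn ℝ 1 (fun x => stress We ε b (A t x) i j) (closure D) := by
    intro i j
    have hA : ∀ i j, ContDiffOn ℝ 1 (fun x => A t x i j) (closure D) := fun i j =>
      contDiffOn_slice (hsol.conformation_regular i j) ht'
    simp only [stress, Matrix.smul_apply, Matrix.sub_apply, smul_eq_mul]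
    exact contDiffOn_const.mul
      ((((contDiffOn_springFactor hA).inv hs).mul (hA i j)).sub contDiffOn_const)
  obtain ⟨i1, e1⟩ := setIntegral_fderiv_apply_eq_zero hDo hDb hu1 hnsp hdiv (hu1.norm_sq ℝ)
  obtain ⟨i2, e2⟩ := setIntegral_inner_laplacian hDo hDb (hsol.velocity_regular_space t ht) hnsp
  obtain ⟨i3, e3⟩ := setIntegral_fderiv_apply_eq_zero hDo hDb hu1 hnsp hdiv
    (hsol.pressure_regular t ht)
  obtain ⟨i4, i5, e4⟩ := setIntegral_inner_divMat hDo hDb hu1 hnsp hstress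
  refine ⟨i5, ?_⟩
  -- The momentum equation paired with `u`. Convection becomes half the transport of `‖u‖²` and the
  -- pressure term becomes transport of `p`, both of mean zero.
  have hpt : ∀ x ∈ D, Re * ⟪u t x, u' (t, x) (1, 0)⟫_ℝ =
      -(Re / 2) * fderiv ℝ (fun y => ‖u t y‖ ^ 2) x (u t x)
        + (1 - ε) * ⟪u t x, Laplacian.laplacian (u t) x⟫_ℝ - fderiv ℝ (p t) x (u t x)
        + ⟪u t x, divMat (fun y => stress We ε b (A t y)) x⟫_ℝ := by
    intro x hx
    have hd := h.velocity_hasFDerivWithinAt (t, x) ⟨ht', subset_closure hx⟩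
    have h2 := (hasFDerivWithinAt_space ht' hd).hasFDerivAt
        (mem_of_superset (hDo.mem_nhds hx) subset_closure)
    have h1 : HasDerivAt (fun s => u s x) (u' (t, x) (1, 0)) t :=
      (hasDerivWithinAt_time (subset_closure hx) hd).hasDerivAt (Ico_mem_nhds ht.1 ht.2)
    have h3 := hsol.momentum t ht x hx
    rw [h1.deriv] at h3
    have h4 := congrArg (fun w => ⟪u t x, w⟫_ℝ) h3
    simp only [inner_smul_right, inner_add_right, inner_sub_right, inner_gradient_right_eq] at h4
    rw [(h2.norm_sq).fderiv, ← h2.fderiv]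
    simp only [smul_apply, ContinuousLinearMap.comp_apply, innerSL_apply_apply, nsmul_eq_mul]
    push_cast
    linarith
  rw [← integral_const_mul, setIntegral_congr_fun hDo.measurableSet hpt, integral_add, integral_sub,
    integral_add, integral_const_mul, integral_const_mul, e1, e2, e3, e4]
  · ring
  · exact i1.const_mul _
  · exact i2.const_mul _
  · exact (i1.const_mul _).add (i2.const_mul _)
  · exact i3
  · exact ((i1.const_mul _).add (i2.const_mul _)).sub i3
  · exact i4

/-- The entropy balance. -/
theorem BoundaryDerivatives.entropy_balance
    (h : BoundaryDerivatives T D u A u' A') (hsol : IsRegularSolution Re We ε b T D u p A)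
    (hb : b ≠ 0) (hDo : IsOpen D) (hDb : Bornology.IsBounded D) {t : ℝ} (ht : t ∈ Ioo 0 T)
    (hA : ∀ x ∈ closure D, (A t x).PosDef) (hs : ∀ x ∈ closure D, springFactor b (A t x) ≠ 0)
    (hτ : IntegrableOn (fun x => ∑ i, ∑ j, gradMat (u t) x i j * stress We ε b (A t x) i j) D) :
    ε / (2 * We) * ∫ x in D, entropyDeriv b (A t x) (fun i j => A' i j (t, x)) (1, 0) =
      (∫ x in D, ∑ i, ∑ j, gradMat (u t) x i j * stress We ε b (A t x) i j)
        - ε / (2 * We ^ 2) * ∫ x in D, dissipationDensity b (A t x) := by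
  have ht' : t ∈ Ico 0 T := ⟨ht.1.le, ht.2⟩
  have hu1 : ContDiffOn ℝ 1 (u t) (closure D) := contDiffOn_slice hsol.velocity_regular ht'
  have hdet : ∀ x ∈ closure D, (A t x).det ≠ 0 := fun x hx => (hA x hx).det_pos.ne'
  have hent : ContDiffOn ℝ 1 (fun x => entropyDensity b (A t x)) (closure D) :=
    contDiffOn_entropyDensity (fun i j => contDiffOn_slice (hsol.conformation_regular i j) ht')
      hdet hs
  obtain ⟨i1, e1⟩ := setIntegral_fderiv_apply_eq_zero hDo hDb hu1 (hsol.no_slip t ht')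
    (hsol.incompressible t ht) hent
  have i2 : IntegrableOn (fun x => dissipationDensity b (A t x)) D :=
    integrableOn_of_eqOn_continuousOn_closure hDo hDb (continuousOn_dissipationDensity
      (continuousOn_slice hsol.conformation_continuousOn ht') hdet hs) fun x _ => rfl
  have hpt : ∀ x ∈ D, ε / (2 * We) * entropyDeriv b (A t x) (fun i j => A' i j (t, x)) (1, 0) =
      (∑ i, ∑ j, gradMat (u t) x i j * stress We ε b (A t x) i j)
        - ε / (2 * We ^ 2) * dissipationDensity b (A t x)
        - ε / (2 * We) * fderiv ℝ (fun y => entropyDensity b (A t y)) x (u t x) := by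
    intro x hx
    have hxc := subset_closure hx
    have hd : fderiv ℝ (fun y => entropyDensity b (A t y)) x (u t x) =
        entropyDeriv b (A t x) (fun i j => A' i j (t, x)) (0, u t x) := by
      have h1 := hasFDerivWithinAt_entropyDensity hb
        (fun i j => h.conformation_hasFDerivWithinAt i j (t, x) ⟨ht', hxc⟩)
        (hdet x hxc) (hs x hxc)
      rw [((hasFDerivWithinAt_space ht' h1).hasFDerivAt
        (mem_of_superset (hDo.mem_nhds hx) subset_closure)).fderiv]
      rfl
    -- The directions `(1, 0)` and `(0, u)` add up to the material derivative, for which the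
    -- conformation equation gives the rate.
    have hsum : entropyDeriv b (A t x) (fun i j => A' i j (t, x)) (1, 0)
        + entropyDeriv b (A t x) (fun i j => A' i j (t, x)) (0, u t x) =
        2 * ((springFactor b (A t x))⁻¹ * (∑ i, ∑ j, gradMat (u t) x i j * A t x i j)
          - (gradMat (u t) x).trace) - 1 / We * dissipationDensity b (A t x) := by
      rw [← map_add, Prod.mk_add_mk, add_zero, zero_add, entropyDeriv_apply _ _ _
        (fun i j => h.material_derivative_interior hsol hDo ht hx i j), h.gradMat_eq hDo ht' hx]
      refine entropy_production ?_ (hdet x hxc)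
      have := (hA x hxc).1
      rwa [Matrix.IsHermitian, Matrix.conjTranspose_eq_transpose_of_trivial] at this
    -- The weight `ε/(2We)` turns the factor `2` of the entropy production into the `ε/We` of the
    -- stress, so the coupling terms match exactly.
    have hstress : ∑ i, ∑ j, gradMat (u t) x i j * stress We ε b (A t x) i j =
        ε / We * ((springFactor b (A t x))⁻¹ * (∑ i, ∑ j, gradMat (u t) x i j * A t x i j)
          - (gradMat (u t) x).trace) := by
      simp only [stress, Matrix.smul_apply, Matrix.sub_apply, smul_eq_mul, Matrix.one_apply,
        Matrix.trace, Matrix.diag_apply, mul_sub, Finset.sum_sub_distrib, Finset.mul_sum,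
        mul_ite, mul_one, mul_zero, Finset.sum_ite_eq, Finset.mem_univ, if_true]
      congr 1
      · exact Finset.sum_congr rfl fun i _ => Finset.sum_congr rfl fun j _ => by ring
      · exact Finset.sum_congr rfl fun i _ => by ring
    rw [hd, hstress, eq_sub_of_add_eq hsum]
    ring
  rw [← integral_const_mul, setIntegral_congr_fun hDo.measurableSet hpt, integral_sub, integral_sub,
    integral_const_mul, integral_const_mul, e1]
  · ring
  · exact hτ
  · exact i2.const_mul _
  · exact hτ.sub (i2.const_mul _)
  · exact i1.const_mul _

end Energy

end FENEP

end

/-! ### Assembly of the free energy identity. -/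

open Set Filter Topology MeasureTheory FENEP in
theorem mainTheorem3 {d : ℕ} (Re We ε b T : ℝ) (hRe : 0 < Re) (hWe : 0 < We)
    (hε : ε ∈ Set.Ioo (0 : ℝ) 1) (hb : 0 < b)
    (D : Set (FENEP.E d)) (hDo : IsOpen D) (hDb : Bornology.IsBounded D)
    (u : ℝ → FENEP.E d → FENEP.E d) (p : ℝ → FENEP.E d → ℝ)
    (A : ℝ → FENEP.E d → Matrix (Fin d) (Fin d) ℝ)
    (hsol : FENEP.IsRegularSolution Re We ε b T D u p A)
    (hA₀ : ∀ x ∈ closure D, (A 0 x).PosDef)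
    (htr₀ : ∀ x ∈ closure D, (A 0 x).trace < b) :
    ∀ t ∈ Set.Ico 0 T,
      (∀ x ∈ closure D, (A t x).PosDef ∧ (A t x).trace < b) ∧
      MeasureTheory.IntegrableOn (fun x => ‖u t x‖ ^ 2) D ∧
      MeasureTheory.IntegrableOn (fun x => FENEP.entropyDensity b (A t x)) D ∧
      MeasureTheory.IntegrableOn (fun x => FENEP.sqNorm (FENEP.gradMat (u t) x)) D ∧
      MeasureTheory.IntegrableOn (fun x => FENEP.dissipationDensity b (A t x)) D ∧
      HasDerivWithinAt
        (fun s => Re / 2 * (∫ x in D, ‖u s x‖ ^ 2)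
          + ε / (2 * We) * ∫ x in D, FENEP.entropyDensity b (A s x))
        (-((1 - ε) * (∫ x in D, FENEP.sqNorm (FENEP.gradMat (u t) x))
          + ε / (2 * We ^ 2) * ∫ x in D, FENEP.dissipationDensity b (A t x)))
        (Set.Ico 0 T) t := by
  obtain ⟨u', A', h⟩ := hsol.exists_boundaryDerivatives hDo
  have hpos : ∀ t ∈ Ico 0 T, ∀ x ∈ closure D, (A t x).PosDef ∧ (A t x).trace < b :=
    fun t ht x hx => hsol.posDef_and_trace_lt hWe hb hDo hDb hA₀ htr₀ ht hx
  have hs : ∀ z ∈ Ico 0 T ×ˢ closure D, springFactor b (A z.1 z.2) ≠ 0 := fun z hz =>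
    (sub_pos.2 ((div_lt_one hb).2 (hpos z.1 hz.1 z.2 hz.2).2)).ne'
  have hdet : ∀ z ∈ Ico 0 T ×ˢ closure D, (A z.1 z.2).det ≠ 0 := fun z hz =>
    (hpos z.1 hz.1 z.2 hz.2).1.det_pos.ne'
  have hcA := hsol.conformation_continuousOn
  have hkin : ContinuousOn (fun z : ℝ × E d => ‖u z.1 z.2‖ ^ 2) (Ico 0 T ×ˢ closure D) :=
    hsol.velocity_regular.continuousOn.norm.pow 2
  have hent : ContinuousOn (fun z : ℝ × E d => entropyDensity b (A z.1 z.2))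
      (Ico 0 T ×ˢ closure D) :=
    (contDiffOn_entropyDensity hsol.conformation_regular hdet hs).continuousOn
  have hgrad : ContinuousOn (fun z : ℝ × E d => sqNorm (spaceGrad (u' z)))
      (Ico 0 T ×ˢ closure D) := continuous_sqNorm.comp_continuousOn h.spaceGrad_continuousOn
  have hdis : ContinuousOn (fun z : ℝ × E d => dissipationDensity b (A z.1 z.2))
      (Ico 0 T ×ˢ closure D) := continuousOn_dissipationDensity hcA hdet hs
  have hgeq : ∀ t ∈ Ico 0 T, ∀ x ∈ D, sqNorm (gradMat (u t) x) = sqNorm (spaceGrad (u' (t, x))) :=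
    fun t ht x hx => by rw [h.gradMat_eq hDo ht hx]
  set F : ℝ → ℝ := fun s => Re / 2 * (∫ x in D, ‖u s x‖ ^ 2)
    + ε / (2 * We) * ∫ x in D, entropyDensity b (A s x) with hF
  set G : ℝ → ℝ := fun t => -((1 - ε) * (∫ x in D, sqNorm (gradMat (u t) x))
    + ε / (2 * We ^ 2) * ∫ x in D, dissipationDensity b (A t x)) with hG
  have hderiv : ∀ t ∈ Ioo 0 T, HasDerivAt F (G t) t := by
    intro t ht
    have ht' : t ∈ Ico 0 T := ⟨ht.1.le, ht.2⟩
    have hst : ∀ x ∈ closure D, springFactor b (A t x) ≠ 0 := fun x hx => hs (t, x) ⟨ht', hx⟩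
    have h1 := hasDerivAt_setIntegral hDb hDo hkin
      (f' := fun z => 2 • (innerSL ℝ (u z.1 z.2)).comp (u' z))
      (((continuousOn_const.clm_apply hsol.velocity_regular.continuousOn).clm_comp
        h.velocity_continuousOn).const_smul 2)
      (fun z hz => (h.velocity_hasFDerivWithinAt z hz).norm_sq) ht
    have h2 := hasDerivAt_setIntegral hDb hDo hent
      (f' := fun z => entropyDeriv b (A z.1 z.2) (fun i j => A' i j z))
      (continuousOn_entropyDeriv hcA h.conformation_continuousOn hdet hs)
      (fun z hz => hasFDerivWithinAt_entropyDensity hb.ne'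
        (fun i j => h.conformation_hasFDerivWithinAt i j z hz) (hdet z hz) (hs z hz)) ht
    obtain ⟨hτ, hk⟩ := h.kinetic_balance hsol hDo hDb ht hst
    have he := h.entropy_balance hsol hb.ne' hDo hDb ht (fun x hx => (hpos t ht' x hx).1) hst hτ
    refine ((h1.const_mul (Re / 2)).add (h2.const_mul (ε / (2 * We)))).congr_deriv ?_
    have hk' : ∫ x in D, (2 • (innerSL ℝ (u t x)).comp (u' (t, x))) ((1 : ℝ), (0 : E d)) =
        2 * ∫ x in D, inner ℝ (u t x) (u' (t, x) (1, 0)) := by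
      rw [← integral_const_mul]
      refine integral_congr_ae (.of_forall fun x => ?_)
      simp
    simp only [hG]
    rw [hk', he]
    linarith
  have hFc : ContinuousOn F (Ico 0 T) :=
    ((continuousOn_setIntegral hDb hDo hkin).const_mul _).add
      ((continuousOn_setIntegral hDb hDo hent).const_mul _)
  -- Continuity is proved for `spaceGrad`, which is continuous up to the boundary and agrees with
  -- `gradMat` on `D`.
  have hGc : ContinuousOn G (Ico 0 T) := by
    have h1 : ContinuousOn (fun t => ∫ x in D, sqNorm (gradMat (u t) x)) (Ico 0 T) :=
      (continuousOn_setIntegral hDb hDo hgrad).congr fun t ht =>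
        setIntegral_congr_fun hDo.measurableSet (hgeq t ht)
    exact ((h1.const_mul _).add ((continuousOn_setIntegral hDb hDo hdis).const_mul _)).neg
  intro t ht
  refine ⟨hpos t ht, ?_, ?_, ?_, ?_, ?_⟩
  · exact integrableOn_of_eqOn_continuousOn_closure hDo hDb (continuousOn_slice hkin ht)
      fun x _ => rfl
  · exact integrableOn_of_eqOn_continuousOn_closure hDo hDb (continuousOn_slice hent ht)
      fun x _ => rfl
  · exact integrableOn_of_eqOn_continuousOn_closure hDo hDb (continuousOn_slice hgrad ht)
      (hgeq t ht)
  · exact integrableOn_of_eqOn_continuousOn_closure hDo hDb (continuousOn_slice hdis ht)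
      fun x _ => rfl
  · change HasDerivWithinAt F (G t) (Ico 0 T) t
    rcases ht.1.eq_or_lt with rfl | hpos_t
    · have hmem : Ioo 0 T ∈ 𝓝[>] (0 : ℝ) := Ioo_mem_nhdsGT ht.2
      -- The balances hold for positive times only. At `0` the one-sided derivative is the limit of
      -- the derivatives `G s`, since `F` and `G` are continuous there.
      refine (hasDerivWithinAt_Ici_of_tendsto_deriv (s := Ioo 0 T)
        (fun s hs => (hderiv s hs).differentiableAt.differentiableWithinAt)
        ((hFc 0 ht).mono Ioo_subset_Ico_self) hmem ?_).mono Ico_subset_Ici_self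
      have h1 : Tendsto G (𝓝[>] 0) (𝓝 (G 0)) :=
        (hGc 0 ht).mono_of_mem_nhdsWithin (mem_of_superset hmem Ioo_subset_Ico_self)
      refine h1.congr' ?_
      filter_upwards [hmem] with s hs using (hderiv s hs).deriv.symm
    · exact (hderiv t ⟨hpos_t, ht.2⟩).hasDerivWithinAt
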